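/- Let $n\ge 1$ and let $\mathfrak S_n$ be the set of permutations $\pi=\pi(1)\cdots\pi(n)$ of $[n]=\{1,\dots,n\}$. Write $\mathrm{inv}(\pi)=\#\{i<j:\pi(i)>\pi(j)\}$. An integer-valued permutation statistic is called Mahonian if for every $n\ge1$ it takes each value on $\mathfrak S_n$ exactly as often as $\mathrm{inv}$ does. Write $\pi^{\mathrm c}(i)=n+1-\pi(i)$ and $\mathrm{pone}(\pi)=\pi^{-1}(1)$. **Linear statistics.** Let $\mathrm{Des}(\pi)=\{1\le i<n:\pi(i)>\pi(i+1)\}$, $\mathrm{des}(\pi)=\#\mathrm{Des}(\pi)$, $\mathrm{dbot}(\pi)=\sum_{i\in\mathrm{Des}(\pi)}\pi(i+1)$, $\mathrm{ddif}(\pi)=\sum_{i\in\mathrm{Des}(\pi)}(\pi(i)-\pi(i+1))$, and $$(2\underline{31})(\pi)=\#\{(i,j): i<j<n,\ \pi(j+1)<\pi(i)<\pi(j)\},$$ $$(\underline{31}2)(\pi)=\#\{(j,i): j+1<i\le n,\ \pi(j+1)<\pi(i)<\pi(j)\},$$ $$(\underline{13}2)(\pi)=\#\{(j,i): j+1<i\le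 n,\ \pi(j)<\pi(i)<\pi(j+1)\}.$$ Put $\mathrm{mak}=\mathrm{dbot}+(2\underline{31})$, $\mathrm{mad}=\mathrm{ddif}+(2\underline{31})$, $\mathrm{makl}=\mathrm{dbot}+(\underline{31}2)$, $\mathrm{madl}=\mathrm{ddif}+(\underline{31}2)$, $\mathrm{sist}'=(\underline{13}2)+(\underline{13}2)+(2\underline{31})+\mathrm{des}$ and $\mathrm{sist}''=(\underline{13}2)+(2\underline{31})+(2\underline{31})+\mathrm{des}$. **Cyclic statistics.** Let $\mathrm{Ep}(\pi)=\{i\in[n]:\pi(i)>i\}$, $\mathrm{exc}(\pi)=\#\mathrm{Ep}(\pi)$, $\mathrm{edif}(\pi)=\sum_{i\in\mathrm{Ep}(\pi)}(\pi(i)-i)$, $\mathrm{ebot}(\pi)=\sum_{i\in\mathrm{Ep}(\pi)}i$. For $i\in\mathrm{Ep}(\pi)$ let $s_i=\#\{j\in\mathrm{Ep}(\pi): j<i,\ \pi(j)>\pi(i)\}$, and for $i\in[n]\setminus\mathrm{Ep}(\pi)$ let $s_i=\#\{j\in[n]\setminus\mathrm{Ep}(\pi): j>i,\ \pi(j)<\pi(i)\}$.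 Put $\mathrm{ine}(\pi)=\sum_{i=1}^n s_i$ and $\mathrm{den}=\mathrm{ebot}+\mathrm{ine}$. **Shifted cyclic statistics.** Let $\mathrm{nest}_i(\pi)=\#\{j: j<i<\pi(i)<\pi(j)\text{ or }\pi(j)<\pi(i)\le i<j\}$. Let $\mathrm{vnest}_i(\pi)$ be $\mathrm{nest}_i(\pi)-1$ if $\pi(i)\le i<\mathrm{pone}(\pi)$, $\mathrm{nest}_i(\pi)+1$ if $\pi(i)>i>\mathrm{pone}(\pi)$, and $\mathrm{nest}_i(\pi)$ otherwise. Put $\mathrm{vnest}(\pi)=\sum_{i=1}^n\mathrm{vnest}_i(\pi)$. Let $\mathrm{vbot}(\pi)$ be the sum of all $i\in[n-1]$ such that $i+1$ is not of the form $\pi(j)$ with $j\in\mathrm{Ep}(\pi)$, and let $\mathrm{vedif}(\pi)=\sum_{i\in\mathrm{Ep}(\pi)}(\pi(i)-1-i)+n-\mathrm{pone}(\pi)$. **Theorem.** The following eighteen permutation statistics are all Mahonian: - $\mathrm{mak}'(\pi)=\mathrm{mak}(\pi)+(1-n)\,\mathrm{des}(\pi)+\pi(n)+n(n-3)/2$ -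 $\mathrm{mad}'(\pi)=\mathrm{mad}(\pi)+2\pi(n)-n-1$ - $\mathrm{makl}'(\pi)=\mathrm{makl}(\pi)-n\,\mathrm{des}(\pi)+n(n-1)/2$ - $\mathrm{madl}'(\pi)=\mathrm{madl}(\pi)-\mathrm{des}(\pi)+\pi(n)-1$ - $\mathrm{fz3}(\pi)=\mathrm{ebot}(\pi)+\mathrm{edif}(\pi)-\mathrm{exc}(\pi)-\mathrm{ine}(\pi)$ - $\mathrm{fz4}(\pi)=2\,\mathrm{edif}(\pi)-\mathrm{exc}(\pi)-\mathrm{ine}(\pi)$ - $\mathrm{inv}'(\pi)=\mathrm{inv}(\pi)+2\pi(n)-1-n$ - $\mathrm{den}'(\pi)=\mathrm{den}(\pi)+(1-n)\,\mathrm{exc}(\pi)+\pi(n)+n(n-3)/2$ - $\mathrm{fz3}'(\pi)=\mathrm{fz3}(\pi)-n\,\mathrm{exc}(\pi)+n(n-1)/2$ - $\mathrm{fz4}'(\pi)=\mathrm{fz4}(\pi)-\mathrm{exc}(\pi)+\pi(n)-1$ - $\mathrm{yzl1}(\pi)=\mathrm{vbot}(\pi)+\mathrm{vnest}(\pi)$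 - $\mathrm{yzl2}(\pi)=\mathrm{vedif}(\pi)+\mathrm{vnest}(\pi)$ - $\mathrm{yzl3}(\pi)=\mathrm{vbot}(\pi)+\mathrm{vedif}(\pi)-(n-1-\mathrm{exc}(\pi))-\mathrm{vnest}(\pi)$ - $\mathrm{yzl4}(\pi)=2\,\mathrm{vedif}(\pi)-(n-1-\mathrm{exc}(\pi))-\mathrm{vnest}(\pi)$ - $\mathrm{yzl1}'(\pi)=\mathrm{yzl1}(\pi)+(n-1)\,\mathrm{exc}(\pi)+\mathrm{pone}(\pi)+(-n^2+n-2)/2$ - $\mathrm{yzl2}'(\pi)=\mathrm{yzl2}(\pi)+2\,\mathrm{pone}(\pi)-n-1$ - $\mathrm{yzl3}'(\pi)=\mathrm{yzl3}(\pi)+n\,\mathrm{exc}(\pi)-n(n-1)/2$ - $\mathrm{yzl4}'(\pi)=\mathrm{yzl4}(\pi)+\mathrm{exc}(\pi)+\mathrm{pone}(\pi)-n$ In particular, for every $n\ge1$ and every $\pi\in\mathfrak S_n$, $$\mathrm{mad}'(\pi)=\mathrm{sist}''(\pi^{\mathrm c}),\qquad \mathrm{madl}'(\pi)=\mathrm{sist}'(\pi^{\mathrm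 c}),\qquad \mathrm{makl}'(\pi)=\mathrm{makl}(\pi^{\mathrm c}).$$ -/

import Mathlib

namespace PermStat

open Finset

/-! Permutations of `{1, …, n}` are elements of `Equiv.Perm (Fin n)`; `word π i` is the `i`-th letter
of the one-line notation of `π`, with positions and letters both counted from `1`. -/

/-- The letter `π(i)` for `1 ≤ i ≤ n` (and `0` for `i` outside this range, which is never used). -/
def word {n : ℕ} (π : Equiv.Perm (Fin n)) (i : ℕ) : ℕ :=
  if h : 1 ≤ i ∧ i ≤ n then (π ⟨i - 1, by omega⟩ : ℕ) + 1 else 0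

/-- The last letter `π(n)`. -/
def last {n : ℕ} (π : Equiv.Perm (Fin n)) : ℕ := word π n

/-- The position `π⁻¹(1)` of the letter `1`. -/
def pone {n : ℕ} (π : Equiv.Perm (Fin n)) : ℕ := word π⁻¹ 1

/-- The complement `π ↦ (n + 1 - π(1)) ⋯ (n + 1 - π(n))`. -/
def compl {n : ℕ} (π : Equiv.Perm (Fin n)) : Equiv.Perm (Fin n) := π.trans Fin.revPerm

/-! ### Inversions, and linear statistics -/

/-- The inversion number. -/
def inv {n : ℕ} (π : Equiv.Perm (Fin n)) : ℕ :=
  #{p ∈ Icc 1 n ×ˢ Icc 1 n | p.1 < p.2 ∧ word π p.1 > word π p.2}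

/-- The descent set. -/
def Des {n : ℕ} (π : Equiv.Perm (Fin n)) : Finset ℕ :=
  {i ∈ Ico 1 n | word π i > word π (i + 1)}

/-- The descent number; this is also the number of occurrences of the vincular pattern `21` with
both letters underlined. -/
def des {n : ℕ} (π : Equiv.Perm (Fin n)) : ℕ := #(Des π)

/-- The multiset of descent bottoms, each descent bottom `b` being repeated `b` times. -/
def Dbot {n : ℕ} (π : Equiv.Perm (Fin n)) : Multiset ℕ :=
  ∑ i ∈ Des π, Multiset.replicate (word π (i + 1)) (word π (i + 1))

/-- The multiset union of the intervals `{π(i+1)+1, …, π(i)}` over all descents `i`. -/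
def Ddif {n : ℕ} (π : Equiv.Perm (Fin n)) : Multiset ℕ :=
  ∑ i ∈ Des π, (Ioc (word π (i + 1)) (word π i)).val

def dbot {n : ℕ} (π : Equiv.Perm (Fin n)) : ℕ := (Dbot π).card

def ddif {n : ℕ} (π : Equiv.Perm (Fin n)) : ℕ := (Ddif π).card

/-- Occurrences of the vincular pattern `231` in which the letters `31` are adjacent. -/
def pat2_31 {n : ℕ} (π : Equiv.Perm (Fin n)) : ℕ :=
  #{p ∈ Icc 1 n ×ˢ Ico 1 n |
    p.1 < p.2 ∧ word π (p.2 + 1) < word π p.1 ∧ word π p.1 < word π p.2}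

/-- Occurrences of the vincular pattern `312` in which the letters `31` are adjacent. -/
def pat31_2 {n : ℕ} (π : Equiv.Perm (Fin n)) : ℕ :=
  #{p ∈ Ico 1 n ×ˢ Icc 1 n |
    p.1 + 1 < p.2 ∧ word π (p.1 + 1) < word π p.2 ∧ word π p.2 < word π p.1}

/-- Occurrences of the vincular pattern `132` in which the letters `13` are adjacent. -/
def pat13_2 {n : ℕ} (π : Equiv.Perm (Fin n)) : ℕ :=
  #{p ∈ Ico 1 n ×ˢ Icc 1 n |
    p.1 + 1 < p.2 ∧ word π p.1 < word π p.2 ∧ word π p.2 < word π (p.1 + 1)}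

def mak {n : ℕ} (π : Equiv.Perm (Fin n)) : ℕ := dbot π + pat2_31 π

def mad {n : ℕ} (π : Equiv.Perm (Fin n)) : ℕ := ddif π + pat2_31 π

def makl {n : ℕ} (π : Equiv.Perm (Fin n)) : ℕ := dbot π + pat31_2 π

def madl {n : ℕ} (π : Equiv.Perm (Fin n)) : ℕ := ddif π + pat31_2 π

/-- The Simion–Stanton statistic `13-2 + 13-2 + 2-31 + 21`. -/
def sist' {n : ℕ} (π : Equiv.Perm (Fin n)) : ℕ :=
  pat13_2 π + pat13_2 π + pat2_31 π + des π

/-- The Simion–Stanton statistic `13-2 + 2-31 + 2-31 + 21`. -/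
def sist'' {n : ℕ} (π : Equiv.Perm (Fin n)) : ℕ :=
  pat13_2 π + pat2_31 π + pat2_31 π + des π

/-! ### Cyclic statistics -/

/-- The set of excedance positions. -/
def Ep {n : ℕ} (π : Equiv.Perm (Fin n)) : Finset ℕ := {i ∈ Icc 1 n | word π i > i}

/-- The set of positions that are not excedance positions. -/
def Nep {n : ℕ} (π : Equiv.Perm (Fin n)) : Finset ℕ := {i ∈ Icc 1 n | word π i ≤ i}

/-- The set of excedances, that is, of the letters at the excedance positions. -/
def Exc {n : ℕ} (π : Equiv.Perm (Fin n)) : Finset ℕ := (Ep π).image (word π)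

def exc {n : ℕ} (π : Equiv.Perm (Fin n)) : ℕ := #(Exc π)

/-- The multiset union of the intervals `{i+1, …, π(i)}` over all excedance positions `i`. -/
def Edif {n : ℕ} (π : Equiv.Perm (Fin n)) : Multiset ℕ :=
  ∑ i ∈ Ep π, (Ioc i (word π i)).val

/-- The multiset of excedance positions, each position `i` being repeated `i` times. -/
def Ebot {n : ℕ} (π : Equiv.Perm (Fin n)) : Multiset ℕ :=
  ∑ i ∈ Ep π, Multiset.replicate i i

/-- The side number of the position `i`: if `i` is an excedance position, the number of larger
letters to the left of `π(i)` in the subword of excedances; otherwise the number of smaller letters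
to the right of `π(i)` in the subword of non-excedances. -/
def side {n : ℕ} (π : Equiv.Perm (Fin n)) (i : ℕ) : ℕ :=
  if i ∈ Ep π then #{j ∈ Ep π | j < i ∧ word π j > word π i}
  else #{j ∈ Nep π | i < j ∧ word π j < word π i}

/-- The multiset containing each letter `π(i)` as often as the side number of `i` says. -/
def Ine {n : ℕ} (π : Equiv.Perm (Fin n)) : Multiset ℕ :=
  ∑ i ∈ Icc 1 n, Multiset.replicate (side π i) (word π i)

def edif {n : ℕ} (π : Equiv.Perm (Fin n)) : ℕ := (Edif π).card

def ebot {n : ℕ} (π : Equiv.Perm (Fin n)) : ℕ := (Ebot π).card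

def ine {n : ℕ} (π : Equiv.Perm (Fin n)) : ℕ := (Ine π).card

/-- Denert's statistic. -/
def den {n : ℕ} (π : Equiv.Perm (Fin n)) : ℕ := ebot π + ine π

/-! ### Shifted cyclic statistics -/

/-- The number of nestings at `i`. -/
def nest {n : ℕ} (π : Equiv.Perm (Fin n)) (i : ℕ) : ℕ :=
  #{j ∈ Icc 1 n | (j < i ∧ i < word π i ∧ word π i < word π j) ∨
    (word π j < word π i ∧ word π i ≤ i ∧ i < j)}

/-- The shifted number of nestings at `i`. The subtraction is a true one: if
`π(i) ≤ i < pone(π)`, then `j = pone(π)` is counted in `nest π i`, since `π(j) = 1 < π(i)`. -/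
def vnestAt {n : ℕ} (π : Equiv.Perm (Fin n)) (i : ℕ) : ℕ :=
  if word π i ≤ i ∧ i < pone π then nest π i - 1
  else if word π i > i ∧ i > pone π then nest π i + 1
  else nest π i

/-- The multiset containing each `i` as often as the shifted number of nestings at `i` says. -/
def Vnest {n : ℕ} (π : Equiv.Perm (Fin n)) : Multiset ℕ :=
  ∑ i ∈ Icc 1 n, Multiset.replicate (vnestAt π i) i

/-- The set of those `i` in `{1, …, n-1}` for which `i + 1` is not an excedance. -/
def Vnex {n : ℕ} (π : Equiv.Perm (Fin n)) : Finset ℕ := {i ∈ Ico 1 n | i + 1 ∉ Exc π}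

/-- The multiset of the elements of `Vnex π`, each element `i` being repeated `i` times. -/
def Vbot {n : ℕ} (π : Equiv.Perm (Fin n)) : Multiset ℕ :=
  ∑ i ∈ Vnex π, Multiset.replicate i i

/-- The multiset union of the intervals `{i+1, …, π(i)-1}` over all excedance positions `i`,
together with the interval `{pone(π)+1, …, n}`. -/
def Vedif {n : ℕ} (π : Equiv.Perm (Fin n)) : Multiset ℕ :=
  (∑ i ∈ Ep π, (Ioo i (word π i)).val) + (Ioc (pone π) n).val

def vnest {n : ℕ} (π : Equiv.Perm (Fin n)) : ℕ := (Vnest π).card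

def vbot {n : ℕ} (π : Equiv.Perm (Fin n)) : ℕ := (Vbot π).card

def vedif {n : ℕ} (π : Equiv.Perm (Fin n)) : ℕ := (Vedif π).card

/-! ### The eighteen statistics

All of them are integer-valued by definition. The divisions by `2` are exact, as their numerators
are even. -/

def mak' {n : ℕ} (π : Equiv.Perm (Fin n)) : ℤ :=
  mak π + (1 - n) * des π + last π + (n * (n - 3) : ℤ) / 2

def mad' {n : ℕ} (π : Equiv.Perm (Fin n)) : ℤ :=
  mad π + 2 * last π - n - 1

def makl' {n : ℕ} (π : Equiv.Perm (Fin n)) : ℤ :=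
  makl π - n * des π + (n * (n - 1) : ℤ) / 2

def madl' {n : ℕ} (π : Equiv.Perm (Fin n)) : ℤ :=
  madl π - des π + last π - 1

def fz3 {n : ℕ} (π : Equiv.Perm (Fin n)) : ℤ :=
  ebot π + edif π - exc π - ine π

def fz4 {n : ℕ} (π : Equiv.Perm (Fin n)) : ℤ :=
  2 * edif π - exc π - ine π

def inv' {n : ℕ} (π : Equiv.Perm (Fin n)) : ℤ :=
  inv π + 2 * last π - 1 - n

def den' {n : ℕ} (π : Equiv.Perm (Fin n)) : ℤ :=
  den π + (1 - n) * exc π + last π + (n * (n - 3) : ℤ) / 2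

def fz3' {n : ℕ} (π : Equiv.Perm (Fin n)) : ℤ :=
  fz3 π - n * exc π + (n * (n - 1) : ℤ) / 2

def fz4' {n : ℕ} (π : Equiv.Perm (Fin n)) : ℤ :=
  fz4 π - exc π + last π - 1

def yzl1 {n : ℕ} (π : Equiv.Perm (Fin n)) : ℤ :=
  vbot π + vnest π

def yzl2 {n : ℕ} (π : Equiv.Perm (Fin n)) : ℤ :=
  vedif π + vnest π

/-- The number `n - 1 - exc π` is the number of positions `i ≠ pone π` with `π(i) ≤ i`. -/
def yzl3 {n : ℕ} (π : Equiv.Perm (Fin n)) : ℤ :=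
  vbot π + vedif π - (n - 1 - exc π) - vnest π

def yzl4 {n : ℕ} (π : Equiv.Perm (Fin n)) : ℤ :=
  2 * vedif π - (n - 1 - exc π) - vnest π

def yzl1' {n : ℕ} (π : Equiv.Perm (Fin n)) : ℤ :=
  yzl1 π + (n - 1) * exc π + pone π + (-(n : ℤ) ^ 2 + n - 2) / 2

def yzl2' {n : ℕ} (π : Equiv.Perm (Fin n)) : ℤ :=
  yzl2 π + 2 * pone π - n - 1

def yzl3' {n : ℕ} (π : Equiv.Perm (Fin n)) : ℤ :=
  yzl3 π + n * exc π - (n * (n - 1) : ℤ) / 2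

def yzl4' {n : ℕ} (π : Equiv.Perm (Fin n)) : ℤ :=
  yzl4 π + exc π + pone π - n

/-- A statistic is Mahonian if, on the permutations of `{1, …, n}` for every `n ≥ 1`, it takes each
value exactly as often as the inversion number does. -/
def IsMahonian (st : ∀ {n : ℕ}, Equiv.Perm (Fin n) → ℤ) : Prop :=
  ∀ n : ℕ, 1 ≤ n → ∀ k : ℤ,
    #{π : Equiv.Perm (Fin n) | st π = k} = #{π : Equiv.Perm (Fin n) | (inv π : ℤ) = k}

end PermStat

/-! A permutation is encoded as a history: a path with one step per letter or position `v`,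
recording whether an arc opens at `v` (`b`), whether one closes (`t`), and a weight bounded by the
number of arcs that stay open. There are two encodings. `linHist` uses descents as arcs, with the
2-31 embracing number of `v` as weight; `cycHist` uses excedances, with the side number of the
letter `v`. Both are injective into the valid histories of length `n` that return to height 0, and
`card_paths` counts `n!` of these, so both are bijections. Hence `dbot`, `ddif`, `des`, `pat2_31`
have the same joint distribution as `ebot`, `edif`, `exc`, `ine`.

Three facts settle the unprimed statistics. `inv_eq_edif_add_ine` puts `inv` in terms of heights and
weights. The generating functions of bottoms plus weights and of heights plus weights over histories
satisfy recurrences with the same solution `qPath`, by the two Pascal rules for Gaussian binomials;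
this makes `den` Mahonian. Complementing every weight (`rev`) exchanges the patterns 2-31 and 31-2,
since together with `des` they sum to `ddif`.

The primed statistics involve the last letter. Appending a new least letter (`linShift`, and
`cycShift` after a rotation of the positions) embeds the permutations of size `n` into those of size
`n + 1` that end with 1. In both encodings these are the histories with the same property `Shifted`,
so the bijection through histories restricts to them (`cyc_equidist_lin_of_shift`). Complementing
weights within their smaller ranges is a further symmetry (`equidist_shiftRev`). Two direct
bijections anchor the chain: `inv'` is `inv` after rotation, and `makl'` is `makl` after
complementation. The identities with `sist'`, `sist''` and `makl` come from telescoping along the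
word on one side of a letter.

Finally, `rotInv` sends `π` to `π⁻¹(2) ⋯ π⁻¹(n) π⁻¹(1)` and carries the shifted cyclic statistics of
`π` to the ordinary ones, so the eight `yzl` statistics follow from `den`, `inv`, `fz3`, `fz4` and
their primed forms. -/

namespace PermStat

open Finset

/-! ### Gaussian binomial coefficients -/

section Gauss

variable {R : Type*} [CommRing R] (q : R)

/-- The `q`-integer `1 + q + ⋯ + q ^ (k - 1)`. -/
def qInt (k : ℕ) : R := ∑ s ∈ range k, q ^ s

/-- The `q`-factorial. -/
def qFact (k : ℕ) : R := ∏ j ∈ range k, qInt q (j + 1)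

/-- The Gaussian binomial coefficient. -/
def qBinom : ℕ → ℕ → R
  | _, 0 => 1
  | 0, _ + 1 => 0
  | i + 1, h + 1 => qBinom i h + q ^ (h + 1) * qBinom i (h + 1)

@[simp] lemma qBinom_zero_right (i : ℕ) : qBinom q i 0 = 1 := by cases i <;> rfl

@[simp] lemma qBinom_zero_succ (h : ℕ) : qBinom q 0 (h + 1) = 0 := rfl

lemma qBinom_succ_succ (i h : ℕ) :
    qBinom q (i + 1) (h + 1) = qBinom q i h + q ^ (h + 1) * qBinom q i (h + 1) := rfl

lemma qInt_succ (k : ℕ) : qInt q (k + 1) = 1 + q * qInt q k := by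
  simp only [qInt, Finset.sum_range_succ', Finset.mul_sum, pow_succ', pow_zero]
  ring

lemma qFact_succ (k : ℕ) : qFact q (k + 1) = qFact q k * qInt q (k + 1) :=
  Finset.prod_range_succ _ _

/-- The second Pascal rule, multiplied by a power of `q` so that the exponent `i - h`, negative for
`h > i`, does not occur. -/
lemma qBinom_pascal (i h : ℕ) :
    q ^ (h + 1) * qBinom q (i + 1) (h + 1)
      = q ^ (i + 1) * qBinom q i h + q ^ (h + 1) * qBinom q i (h + 1) := by
  induction i generalizing h with
  | zero => cases h <;> simp [qBinom_succ_succ]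
  | succ i ih =>
    rw [qBinom_succ_succ q (i + 1) h]
    cases h with
    | zero =>
      have h1 := ih 0
      simp only [qBinom_zero_right] at h1 ⊢
      linear_combination q * h1 - q * qBinom_succ_succ q i 0 - q * qBinom_zero_right q i
    | succ h =>
      have h1 := ih h
      have h2 := ih (h + 1)
      have h3 := qBinom_succ_succ q i h
      have h4 := qBinom_succ_succ q i (h + 1)
      linear_combination q * h1 + q ^ (h + 2) * h2 - q ^ (i + 2) * h3 - q ^ (h + 2) * h4

/-- The absorption identity. It disposes of the factor `qInt q (k + 1)` that the free choice of a
weight produces. -/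
lemma qInt_mul_qBinom (i h : ℕ) :
    qInt q (h + 1) * qBinom q (i + 1) (h + 1) = qInt q (i + 1) * qBinom q i h := by
  induction i generalizing h with
  | zero => cases h <;> simp [qBinom_succ_succ, qInt]
  | succ i ih =>
    rw [qBinom_succ_succ q (i + 1) h, qInt_succ q (i + 1)]
    cases h with
    | zero =>
      have h1 := ih 0
      simp only [qBinom_zero_right] at h1 ⊢
      have h2 : qInt q (0 + 1) = 1 := by simp [qInt]
      rw [h2] at h1 ⊢
      linear_combination q * h1
    | succ h =>
      have h1 := ih h
      have h2 := ih (h + 1)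
      have h3 := qBinom_succ_succ q i h
      have h4 := qInt_succ q (h + 1)
      linear_combination q * h1 + q ^ (h + 2) * h2 - q * qInt q (i + 1) * h3
        + qBinom q (i + 1) (h + 1) * h4

/-- The generating function of the histories of length `i` that end at height `h`. -/
def qPath (i h : ℕ) : R := q ^ (∑ j ∈ range (h + 1), j) * qBinom q i h * qFact q i

/-- The two summands combine by the defining recurrence of `qBinom` into one coefficient with upper
index `i + 1`, to which absorption applies. -/
lemma qInt_mul_qPath_add (i k : ℕ) :
    qInt q (k + 1) * (qPath q i k + qPath q i (k + 1))
      = q ^ (∑ j ∈ range (k + 1), j) * qBinom q i k * qFact q (i + 1) := by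
  have h1 := qInt_mul_qBinom q i k
  rw [qBinom_succ_succ] at h1
  simp only [qPath, Finset.sum_range_succ _ (k + 1), pow_add, qFact_succ]
  linear_combination q ^ (∑ j ∈ range (k + 1), j) * qFact q i * h1

lemma qPath_zero_right (i : ℕ) : qPath q i 0 = qFact q i := by simp [qPath]

end Gauss

/-! ### Histories -/

/-- A step of a history: whether a descent bottom occurs, whether a descent top occurs, and the
weight of the step. -/
abbrev Step := Bool × Bool × ℕ

/-- The height at the end of a history. The latest step stands first. -/
def lht : List Step → ℕ
  | [] => 0
  | (b, t, _) :: l => lht l + b.toNat - t.toNat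

/-- The number of bottoms. -/
def ldes : List Step → ℕ
  | [] => 0
  | (b, _, _) :: l => ldes l + b.toNat

/-- The sum of the bottoms. -/
def lbot : List Step → ℕ
  | [] => 0
  | (b, _, _) :: l => lbot l + if b then l.length + 1 else 0

/-- The sum of the heights. -/
def ldif : List Step → ℕ
  | [] => 0
  | x :: l => ldif l + lht (x :: l)

/-- The sum of the weights. -/
def lsum : List Step → ℕ
  | [] => 0
  | (_, _, s) :: l => lsum l + s

/-- The condition on the weights in a history. -/
def Valid : List Step → Prop
  | [] => True
  | (_, t, s) :: l => Valid l ∧ s + t.toNat ≤ lht l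

/-- The histories in which `k` arcs run across the last step. -/
def halfStep (M : ℕ → Multiset (List Step)) (b : Bool) (k : ℕ) : Multiset (List Step) :=
  (Multiset.range (k + 1)).bind fun s =>
    (M k).map (fun l => (b, false, s) :: l) + (M (k + 1)).map (fun l => (b, true, s) :: l)

/-- The histories of given length and final height. -/
def paths : ℕ → ℕ → Multiset (List Step)
  | 0, 0 => {[]}
  | 0, _ + 1 => 0
  | i + 1, 0 => halfStep (paths i) false 0
  | i + 1, h + 1 => halfStep (paths i) false (h + 1) + halfStep (paths i) true h

lemma mem_halfStep {M : ℕ → Multiset (List Step)} {b : Bool} {k : ℕ} {x : List Step} :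
    x ∈ halfStep M b k ↔
      ∃ t s l, x = (b, t, s) :: l ∧ s ≤ k ∧ l ∈ M (k + t.toNat) := by
  simp only [halfStep, Multiset.mem_bind, Multiset.mem_range, Multiset.mem_add, Multiset.mem_map]
  constructor
  · rintro ⟨s, hs, ⟨l, hl, rfl⟩ | ⟨l, hl, rfl⟩⟩
    · exact ⟨false, s, l, rfl, by omega, by simpa using hl⟩
    · exact ⟨true, s, l, rfl, by omega, by simpa using hl⟩
  · rintro ⟨t, s, l, rfl, hs, hl⟩
    refine ⟨s, by omega, ?_⟩
    cases t
    · exact Or.inl ⟨l, by simpa using hl, rfl⟩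
    · exact Or.inr ⟨l, by simpa using hl, rfl⟩

lemma mem_paths_of_valid (l : List Step) (hl : Valid l) : l ∈ paths l.length (lht l) := by
  induction l with
  | nil => simp [paths, lht]
  | cons x l ih =>
    obtain ⟨b, t, s⟩ := x
    obtain ⟨h1, h2⟩ := hl
    have ih := ih h1
    -- `k` counts the arcs still open after a possible closing; validity says exactly that the
    -- weight is at most `k`.
    obtain ⟨k, hk⟩ : ∃ k, lht l = k + t.toNat := ⟨lht l - t.toNat, by omega⟩
    rw [hk] at ih
    have hmem : (b, t, s) :: l ∈ halfStep (paths l.length) b k :=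
      mem_halfStep.2 ⟨t, s, l, rfl, by omega, ih⟩
    have hh : lht ((b, t, s) :: l) = k + b.toNat := by simp only [lht]; omega
    rw [hh, List.length_cons]
    cases b
    · cases k <;> simp [paths, hmem]
    · simp [paths, hmem]

lemma length_lht_of_mem_paths {i h : ℕ} {l : List Step} (hl : l ∈ paths i h) :
    l.length = i ∧ lht l = h := by
  induction i generalizing h l with
  | zero => cases h <;> simp_all [paths, lht]
  | succ i ih =>
    have key : ∀ b k, l ∈ halfStep (paths i) b k → l.length = i + 1 ∧ lht l = k + b.toNat := by
      intro b k hm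
      obtain ⟨t, s, l', rfl, hs, hl'⟩ := mem_halfStep.1 hm
      obtain ⟨h1, h2⟩ := ih hl'
      simp only [List.length_cons, lht, h1, h2, true_and]
      omega
    cases h with
    | zero => exact key _ _ hl
    | succ h =>
      simp only [paths, Multiset.mem_add] at hl
      rcases hl with hl | hl <;> exact key _ _ hl

section Sums

variable {R : Type*} [CommRing R] (q : R)

/-- The weights `0, …, k` contribute a geometric sum. The rest of the contribution of the step, `c`,
depends neither on the weight nor on `t`, so it factors out. -/
lemma sum_map_halfStep (f : List Step → ℕ) (M : ℕ → Multiset (List Step)) (b : Bool) (k c : ℕ)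
    (hf : ∀ t s l, l ∈ M (k + t.toNat) → f ((b, t, s) :: l) = c + s + f l) :
    ((halfStep M b k).map fun l => q ^ f l).sum
      = q ^ c * (qInt q (k + 1) * (((M k).map fun l => q ^ f l).sum
        + ((M (k + 1)).map fun l => q ^ f l).sum)) := by
  have h0 : ∀ s, ((M k).map fun l => q ^ f ((b, false, s) :: l)).sum
      = q ^ c * q ^ s * ((M k).map fun l => q ^ f l).sum := by
    intro s
    rw [← Multiset.sum_map_mul_left]
    refine congrArg _ (Multiset.map_congr rfl fun l hl => ?_)
    rw [hf false s l (by simpa using hl), pow_add, pow_add]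
  have h1 : ∀ s, ((M (k + 1)).map fun l => q ^ f ((b, true, s) :: l)).sum
      = q ^ c * q ^ s * ((M (k + 1)).map fun l => q ^ f l).sum := by
    intro s
    rw [← Multiset.sum_map_mul_left]
    refine congrArg _ (Multiset.map_congr rfl fun l hl => ?_)
    rw [hf true s l (by simpa using hl), pow_add, pow_add]
  rw [halfStep, Multiset.map_bind, Multiset.sum_bind]
  simp only [Multiset.map_add, Multiset.map_map, Function.comp_def, Multiset.sum_add, h0, h1]
  rw [qInt, Finset.sum_mul, Finset.mul_sum]
  change (∑ s ∈ range (k + 1), _) = _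
  refine Finset.sum_congr rfl fun s _ => ?_
  ring

lemma sum_map_paths_zero (f : List Step → ℕ) (hf : f [] = 0) (h : ℕ) :
    ((paths 0 h).map fun l => q ^ f l).sum = qPath q 0 h := by
  cases h <;> simp [paths, qPath, hf, qFact]

/-- A bottom at step `i + 1` contributes `q ^ (i + 1)`, and the resulting recurrence is
`qBinom_pascal`. -/
lemma sum_lbot_add_lsum (i h : ℕ) :
    ((paths i h).map fun l => q ^ (lbot l + lsum l)).sum = qPath q i h := by
  induction i generalizing h with
  | zero => exact sum_map_paths_zero q _ rfl h
  | succ i ih =>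
    have key : ∀ b k, ((halfStep (paths i) b k).map fun l => q ^ (lbot l + lsum l)).sum
        = q ^ (if b then i + 1 else 0) *
          (q ^ (∑ j ∈ range (k + 1), j) * qBinom q i k * qFact q (i + 1)) := by
      intro b k
      rw [sum_map_halfStep q _ _ b k (if b then i + 1 else 0), ih, ih, qInt_mul_qPath_add]
      intro t s l hl
      simp only [lbot, lsum, (length_lht_of_mem_paths hl).1]
      omega
    cases h with
    | zero => simp [paths, key, qPath]
    | succ h =>
      have hp := qBinom_pascal q i h
      rw [paths, Multiset.map_add, Multiset.sum_add, key, key, qPath,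
        Finset.sum_range_succ _ (h + 1), pow_add]
      simp only [if_true, Bool.false_eq_true, if_false, pow_zero]
      linear_combination (-q ^ (∑ j ∈ range (h + 1), j) * qFact q (i + 1)) * hp

/-- Here every step ending at height `h` contributes `q ^ h`, whether or not it has a bottom, so the
recurrence is the other Pascal rule, with the same solution. -/
lemma sum_ldif_add_lsum (i h : ℕ) :
    ((paths i h).map fun l => q ^ (ldif l + lsum l)).sum = qPath q i h := by
  induction i generalizing h with
  | zero => exact sum_map_paths_zero q _ rfl h
  | succ i ih =>
    have key : ∀ b k, ((halfStep (paths i) b k).map fun l => q ^ (ldif l + lsum l)).sum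
        = q ^ (k + b.toNat) *
          (q ^ (∑ j ∈ range (k + 1), j) * qBinom q i k * qFact q (i + 1)) := by
      intro b k
      rw [sum_map_halfStep q _ _ b k (k + b.toNat), ih, ih, qInt_mul_qPath_add]
      intro t s l hl
      simp only [ldif, lht, lsum, (length_lht_of_mem_paths hl).2]
      omega
    cases h with
    | zero => simp [paths, key, qPath]
    | succ h =>
      have hp := qBinom_succ_succ q i h
      simp only [paths, Multiset.map_add, Multiset.sum_add, key, qPath,
        Finset.sum_range_succ _ (h + 1), Bool.toNat_true, Bool.toNat_false]
      simp only [pow_add, pow_zero, pow_one, mul_one]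
      linear_combination (-q ^ (∑ j ∈ range (h + 1), j) * qFact q (i + 1) * (q ^ h * q)) * hp

end Sums

lemma card_paths (n : ℕ) : (paths n 0).card = n.factorial := by
  have h := sum_lbot_add_lsum (1 : ℤ) n 0
  rw [qPath_zero_right] at h
  have h2 : qFact (1 : ℤ) n = n.factorial := by
    simp [qFact, qInt, ← Finset.prod_range_add_one_eq_factorial]
  rw [h2] at h
  simpa using h

/-- A faithful encoding by histories is onto, as there are only `n!` histories. -/
theorem map_univ_eq_paths {n : ℕ} (D : Equiv.Perm (Fin n) → List Step)
    (hD : Function.Injective D) (hv : ∀ π, Valid (D π)) (hl : ∀ π, (D π).length = n)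
    (h0 : ∀ π, lht (D π) = 0) :
    (univ : Finset (Equiv.Perm (Fin n))).val.map D = paths n 0 := by
  refine Multiset.eq_of_le_of_card_le ?_ ?_
  · rw [Multiset.le_iff_subset ((Finset.nodup _).map hD)]
    intro l hmem
    obtain ⟨π, -, rfl⟩ := Multiset.mem_map.1 hmem
    have := mem_paths_of_valid _ (hv π)
    rwa [hl, h0] at this
  · rw [card_paths, Multiset.card_map]
    simp [Fintype.card_perm]

lemma card_filter_eq_of_sum_pow_eq {α : Type*} [Fintype α] (f g : α → ℕ)
    (h : ∑ a, (Polynomial.X : Polynomial ℤ) ^ f a = ∑ a, (Polynomial.X : Polynomial ℤ) ^ g a)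
    (k : ℕ) : #{a | f a = k} = #{a | g a = k} := by
  have h1 := congrArg (fun p => Polynomial.coeff p k) h
  simp only [Polynomial.finsetSum_coeff, Polynomial.coeff_X_pow] at h1
  have h2 : ∀ f : α → ℕ, (∑ a, if k = f a then (1 : ℤ) else 0) = #{a | f a = k} := by
    intro f
    simp [Finset.sum_boole, eq_comm]
  rw [h2, h2] at h1
  exact_mod_cast h1

/-- The sum of the bottoms and the sum of the heights are interchangeable. -/
theorem card_lbot_eq_card_ldif {n : ℕ} (D : Equiv.Perm (Fin n) → List Step)
    (hD : univ.val.map D = paths n 0) (k : ℕ) :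
    #{π | lbot (D π) + lsum (D π) = k} = #{π | ldif (D π) + lsum (D π) = k} := by
  apply card_filter_eq_of_sum_pow_eq
  have h1 := (sum_lbot_add_lsum (Polynomial.X : Polynomial ℤ) n 0).trans
    (sum_ldif_add_lsum (Polynomial.X : Polynomial ℤ) n 0).symm
  rw [← hD, Multiset.map_map, Multiset.map_map] at h1
  exact h1

/-! ### Histories from sequences -/

/-- The history whose `i`-th step is `(b i, t i, s i)`. -/
def hist (b t : ℕ → Bool) (s : ℕ → ℕ) : ℕ → List Step
  | 0 => []
  | i + 1 => (b (i + 1), t (i + 1), s (i + 1)) :: hist b t s i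

section Hist

variable (b t : ℕ → Bool) (s H : ℕ → ℕ) (n : ℕ)

@[simp] lemma length_hist : (hist b t s n).length = n := by
  induction n with
  | zero => rfl
  | succ n ih => simp [hist, ih]

lemma sum_Icc_succ (f : ℕ → ℕ) : ∑ i ∈ Icc 1 (n + 1), f i = ∑ i ∈ Icc 1 n, f i + f (n + 1) :=
  Finset.sum_Icc_succ_top (by omega) f

lemma ldes_hist : ldes (hist b t s n) = ∑ i ∈ Icc 1 n, (b i).toNat := by
  induction n with
  | zero => rfl
  | succ n ih => rw [sum_Icc_succ, ← ih]; rfl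

lemma lbot_hist : lbot (hist b t s n) = ∑ i ∈ Icc 1 n, if b i then i else 0 := by
  induction n with
  | zero => rfl
  | succ n ih => rw [sum_Icc_succ, ← ih, hist, lbot, length_hist]

lemma lsum_hist : lsum (hist b t s n) = ∑ i ∈ Icc 1 n, s i := by
  induction n with
  | zero => rfl
  | succ n ih => rw [sum_Icc_succ, ← ih]; rfl

variable {b t s H n}

/-- `H` is a height known combinatorially. The balance of openings and closings is stated
additively, which also guarantees that the truncated subtraction in `lht` is exact. -/
lemma lht_hist (h0 : H 0 = 0)
    (hH : ∀ i < n, H i + (b (i + 1)).toNat = H (i + 1) + (t (i + 1)).toNat) :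
    ∀ i ≤ n, lht (hist b t s i) = H i := by
  intro i hi
  induction i with
  | zero => exact h0.symm
  | succ i ih =>
    have h1 := ih (by omega)
    have h2 := hH i (by omega)
    simp only [hist, lht, h1]
    omega

lemma ldif_hist (h0 : H 0 = 0)
    (hH : ∀ i < n, H i + (b (i + 1)).toNat = H (i + 1) + (t (i + 1)).toNat) :
    ldif (hist b t s n) = ∑ i ∈ Icc 1 n, H i := by
  induction n with
  | zero => rfl
  | succ n ih =>
    rw [sum_Icc_succ, ← ih fun i hi => hH i (by omega), ← lht_hist (s := s) h0 hH (n + 1) le_rfl]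
    rfl

lemma valid_hist (h0 : H 0 = 0)
    (hH : ∀ i < n, H i + (b (i + 1)).toNat = H (i + 1) + (t (i + 1)).toNat)
    (hs : ∀ i < n, s (i + 1) + (t (i + 1)).toNat ≤ H i) : Valid (hist b t s n) := by
  induction n with
  | zero => trivial
  | succ n ih =>
    refine ⟨ih (fun i hi => hH i (by omega)) fun i hi => hs i (by omega), ?_⟩
    rw [lht_hist h0 hH n (by omega)]
    exact hs n (by omega)

lemma hist_inj {b' t' : ℕ → Bool} {s' : ℕ → ℕ} (h : hist b t s n = hist b' t' s' n) :
    ∀ i, 1 ≤ i → i ≤ n → b i = b' i ∧ t i = t' i ∧ s i = s' i := by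
  induction n with
  | zero => intro i h1 h2; omega
  | succ n ih =>
    intro i h1 h2
    simp only [hist, List.cons.injEq, Prod.mk.injEq] at h
    rcases Nat.lt_or_ge i (n + 1) with h3 | h3
    · exact ih h.2 i h1 (by omega)
    · obtain rfl : i = n + 1 := by omega
      exact h.1

end Hist

/-! ### One-line notation -/

section Word

variable {n : ℕ} (π : Equiv.Perm (Fin n))

lemma word_eq {i : ℕ} (h1 : 1 ≤ i) (h2 : i ≤ n) : word π i = (π ⟨i - 1, by omega⟩ : ℕ) + 1 :=
  dif_pos ⟨h1, h2⟩

lemma one_le_word {i : ℕ} (h1 : 1 ≤ i) (h2 : i ≤ n) : 1 ≤ word π i := by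
  rw [word_eq π h1 h2]; omega

lemma word_le {i : ℕ} (h1 : 1 ≤ i) (h2 : i ≤ n) : word π i ≤ n := by
  rw [word_eq π h1 h2]; omega

lemma word_inv_word {i : ℕ} (h1 : 1 ≤ i) (h2 : i ≤ n) : word π⁻¹ (word π i) = i := by
  rw [word_eq π⁻¹ (one_le_word π h1 h2) (word_le π h1 h2)]
  simp only [word_eq π h1 h2, Nat.add_sub_cancel]
  simp
  omega

lemma word_word_inv {i : ℕ} (h1 : 1 ≤ i) (h2 : i ≤ n) : word π (word π⁻¹ i) = i := by
  simpa using word_inv_word π⁻¹ h1 h2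

lemma word_mem {i : ℕ} (h : i ∈ Icc 1 n) : word π i ∈ Icc 1 n := by
  rw [mem_Icc] at h ⊢
  exact ⟨one_le_word π h.1 h.2, word_le π h.1 h.2⟩

lemma word_inj {i j : ℕ} (hi : i ∈ Icc 1 n) (hj : j ∈ Icc 1 n) (h : word π i = word π j) :
    i = j := by
  rw [mem_Icc] at hi hj
  rw [← word_inv_word π hi.1 hi.2, h, word_inv_word π hj.1 hj.2]

lemma sum_word {M : Type*} [AddCommMonoid M] (f : ℕ → M) :
    ∑ i ∈ Icc 1 n, f (word π i) = ∑ i ∈ Icc 1 n, f i :=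
  Finset.sum_nbij' (word π) (word π⁻¹) (fun _ h => word_mem π h) (fun _ h => word_mem π⁻¹ h)
    (fun _ h => word_inv_word π (mem_Icc.1 h).1 (mem_Icc.1 h).2)
    (fun _ h => word_word_inv π (mem_Icc.1 h).1 (mem_Icc.1 h).2) (fun _ _ => rfl)

variable {π}

lemma word_ext {σ : Equiv.Perm (Fin n)} (h : ∀ i ∈ Icc 1 n, word π i = word σ i) : π = σ := by
  ext ⟨i, hi⟩
  have := h (i + 1) (by simp; omega)
  rw [word_eq π (by omega) (by omega), word_eq σ (by omega) (by omega)] at this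
  simpa using this

lemma word_inv_eq_iff {i v : ℕ} (hi : i ∈ Icc 1 n) (hv : v ∈ Icc 1 n) :
    word π⁻¹ v = i ↔ word π i = v := by
  rw [mem_Icc] at hi hv
  constructor
  · rintro rfl; exact word_word_inv π hv.1 hv.2
  · rintro rfl; exact word_inv_word π hi.1 hi.2

/-- A permutation may be given by its word and the word of its inverse. -/
lemma exists_perm_word (w p : ℕ → ℕ) (hw : ∀ i ∈ Icc 1 n, w i ∈ Icc 1 n)
    (hp : ∀ i ∈ Icc 1 n, p i ∈ Icc 1 n) (hpw : ∀ i ∈ Icc 1 n, p (w i) = i)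
    (hwp : ∀ i ∈ Icc 1 n, w (p i) = i) :
    ∃ π : Equiv.Perm (Fin n), ∀ i ∈ Icc 1 n, word π i = w i ∧ word π⁻¹ i = p i := by
  simp only [mem_Icc] at *
  let π : Equiv.Perm (Fin n) :=
    { toFun := fun x => ⟨w (x + 1) - 1, by have := hw (x + 1) (by omega); omega⟩
      invFun := fun x => ⟨p (x + 1) - 1, by have := hp (x + 1) (by omega); omega⟩
      left_inv := fun x => by
        have h1 := hw (x + 1) (by omega)
        have h2 := hpw (x + 1) (by omega)
        ext
        simp only
        rw [Nat.sub_add_cancel h1.1, h2]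
        omega
      right_inv := fun x => by
        have h1 := hp (x + 1) (by omega)
        have h2 := hwp (x + 1) (by omega)
        ext
        simp only
        rw [Nat.sub_add_cancel h1.1, h2]
        omega }
  refine ⟨π, fun i hi => ⟨?_, ?_⟩⟩
  · rw [word_eq π hi.1 hi.2]
    change w (i - 1 + 1) - 1 + 1 = _
    rw [Nat.sub_add_cancel hi.1, Nat.sub_add_cancel (hw i hi).1]
  · rw [word_eq π⁻¹ hi.1 hi.2]
    change p (i - 1 + 1) - 1 + 1 = _
    rw [Nat.sub_add_cancel hi.1, Nat.sub_add_cancel (hp i hi).1]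

lemma sum_ite_eq_and (v : ℕ) (hv : v ∈ Icc 1 n) (P : ℕ → Prop) [DecidablePred P] :
    (∑ j ∈ Icc 1 n, if j = v ∧ P j then 1 else 0) = (decide (P v)).toNat := by
  rw [Finset.sum_eq_single_of_mem v hv fun j _ hj => if_neg fun h => hj h.1]
  by_cases h : P v <;> simp [h]

lemma sum_ite_word_eq_and (v : ℕ) (hv : v ∈ Icc 1 n) (P : ℕ → Prop) [DecidablePred P] :
    (∑ j ∈ Icc 1 n, if word π j = v ∧ P j then 1 else 0) = (decide (P (word π⁻¹ v))).toNat := by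
  have hv' := word_mem π⁻¹ hv
  rw [← sum_ite_eq_and (word π⁻¹ v) hv' P]
  refine Finset.sum_congr rfl fun j hj => ?_
  simp only [← word_inv_eq_iff hj hv, eq_comm]

end Word

/-! ### Permutations are determined by partial inversion tables -/

section Lehmer

variable {α β : Type*} [LinearOrder α] [LinearOrder β]

/-- If the letter `f x = g y` stands further left under `f`, and the smaller letters occupy the same
positions under both maps, then every larger letter to its left under `f` gives one under `g`, and
the position `x` itself is extra under `g`. -/
lemma card_inversions_ne_of_lt {S : Finset α} {f g : α → β}
    {x y : α} (hx : x ∈ S) (hxy : x < y) (hv : f x = g y)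
    (hlt : ∀ j ∈ S, f j < f x ↔ g j < f x)
    (hg : ∀ j ∈ S, g j = g y → j = y) :
    #{j ∈ S | j < x ∧ f x < f j} ≠ #{j ∈ S | j < y ∧ g y < g j} := by
  refine (Finset.card_lt_card ?_).ne
  rw [Finset.ssubset_iff_of_subset]
  · refine ⟨x, ?_, by simp⟩
    simp only [mem_filter]
    refine ⟨hx, hxy, lt_of_le_of_ne ?_ ?_⟩
    · rw [← hv, ← not_lt, ← hlt x hx]; exact lt_irrefl _
    · intro h; exact hxy.ne (hg x hx h.symm)
  · intro j hj
    simp only [mem_filter] at hj ⊢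
    obtain ⟨hj, h1, h2⟩ := hj
    refine ⟨hj, h1.trans hxy, lt_of_le_of_ne ?_ ?_⟩
    · rw [← hv, ← not_lt, ← hlt j hj]; exact h2.asymm
    · intro h; exact (h1.trans hxy).ne (hg j hj h.symm)

/-- An arrangement is recovered from its inversion table, indexed by letters, by placing the letters
in increasing order: the least letter placed differently would have different entries. -/
lemma eqOn_of_card_inversions_eq {S : Finset α} {f g : α → β} (hf : Set.InjOn f S)
    (hg : Set.InjOn g S) (himg : S.image f = S.image g)
    (h : ∀ x ∈ S, ∀ y ∈ S, f x = g y →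
      #{j ∈ S | j < x ∧ f x < f j} = #{j ∈ S | j < y ∧ g y < g j}) :
    ∀ x ∈ S, f x = g x := by
  have hfg : ∀ x ∈ S, ∃ y ∈ S, g y = f x := fun x hx =>
    mem_image.1 (himg ▸ mem_image_of_mem f hx)
  have hgf : ∀ x ∈ S, ∃ y ∈ S, f y = g x := fun x hx =>
    mem_image.1 (himg ▸ mem_image_of_mem g hx)
  by_contra! hne
  obtain ⟨x, hx, hxm⟩ := Finset.exists_min_image {x ∈ S | f x ≠ g x} f
    (by obtain ⟨x, hx, hne⟩ := hne; exact ⟨x, by simp [hx, hne]⟩)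
  simp only [mem_filter] at hx hxm
  obtain ⟨hx, hxne⟩ := hx
  obtain ⟨y, hy, hyx⟩ := hfg x hx
  have hlt : ∀ j ∈ S, f j < f x ↔ g j < f x := by
    intro j hj
    constructor
    · intro hlt
      by_contra hc
      exact absurd (hxm j ⟨hj, fun he => hc (he ▸ hlt)⟩) (not_le.2 hlt)
    · intro hlt
      obtain ⟨k, hk, hkj⟩ := hgf j hj
      have hk' : f k = g k := by
        by_contra hc
        exact absurd (hxm k ⟨hk, hc⟩) (not_le.2 (hkj ▸ hlt))
      obtain rfl : j = k := hg hj hk (by rw [← hkj, hk'])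
      rwa [hk']
  have hxy : x ≠ y := fun he => hxne (by rw [← hyx, he])
  rcases lt_or_gt_of_ne hxy with hxy | hxy
  · exact card_inversions_ne_of_lt hx hxy hyx.symm hlt
      (fun j hj he => hg hj hy he) (h x hx y hy hyx.symm)
  · refine card_inversions_ne_of_lt hy hxy hyx (fun j hj => ?_)
      (fun j hj he => hf hj hx he) (h x hx y hy hyx.symm).symm
    rw [hyx, hlt j hj]

end Lehmer

/-! ### The history of a permutation, read off its excedances -/

section Cyclic

variable {n : ℕ} (π : Equiv.Perm (Fin n))

/-- The number of excedance arcs across the gap between `i` and `i + 1`. -/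
def cycHeight (i : ℕ) : ℕ := #{j ∈ Icc 1 n | j ≤ i ∧ i < word π j}

/-- The history of a permutation with respect to its excedances. -/
def cycHist : List Step :=
  hist (fun v => decide (v < word π v)) (fun v => decide (word π⁻¹ v < v))
    (fun v => side π (word π⁻¹ v)) n

lemma mem_Ep {i : ℕ} : i ∈ Ep π ↔ i ∈ Icc 1 n ∧ i < word π i := by simp [Ep]

lemma mem_Nep {i : ℕ} : i ∈ Nep π ↔ i ∈ Icc 1 n ∧ word π i ≤ i := by simp [Nep]

lemma cycHeight_zero : cycHeight π 0 = 0 := by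
  rw [cycHeight, card_eq_zero, filter_eq_empty_iff]
  intro j hj
  rw [mem_Icc] at hj
  omega

lemma cycHeight_last : cycHeight π n = 0 := by
  rw [cycHeight, card_eq_zero, filter_eq_empty_iff]
  intro j hj h
  have := word_mem π hj
  rw [mem_Icc] at this
  omega

/-- Passing `i + 1`, the arcs that end there are lost and those that start there are gained. The
equality holds indicator by indicator. -/
lemma cycHeight_step (i : ℕ) (hi : i < n) :
    cycHeight π i + (decide (i + 1 < word π (i + 1))).toNat
      = cycHeight π (i + 1) + (decide (word π⁻¹ (i + 1) < i + 1)).toNat := by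
  have hm : i + 1 ∈ Icc 1 n := by simp; omega
  rw [← sum_ite_eq_and (i + 1) hm (fun j => i + 1 < word π j),
    ← sum_ite_word_eq_and (π := π) (i + 1) hm (fun j => j < i + 1), cycHeight, cycHeight,
    card_filter, card_filter, ← sum_add_distrib, ← sum_add_distrib]
  refine sum_congr rfl fun j hj => ?_
  split_ifs <;> omega

/-- As many letters cross a gap to the left as to the right. -/
lemma card_cross_left (i : ℕ) :
    #{j ∈ Icc 1 n | i < j ∧ word π j ≤ i} = cycHeight π i := by
  have h := sum_word π (fun j => if j ≤ i then 1 else 0)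
  have h1 : #{j ∈ Icc 1 n | i < j ∧ word π j ≤ i} + ∑ j ∈ Icc 1 n, (if j ≤ i then 1 else 0)
      = cycHeight π i + ∑ j ∈ Icc 1 n, (if word π j ≤ i then 1 else 0) := by
    rw [cycHeight, card_filter, card_filter, ← sum_add_distrib, ← sum_add_distrib]
    refine sum_congr rfl fun j hj => ?_
    split_ifs <;> omega
  omega

/-- For an excedance letter `i + 1`, the arcs counted by its side number cross the gap below it, and
so does its own arc. For a non-excedance letter the counted arcs cross that gap leftwards, and as
many cross leftwards as rightwards. -/
lemma side_add_le (i : ℕ) (hi : i < n) :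
    side π (word π⁻¹ (i + 1)) + (decide (word π⁻¹ (i + 1) < i + 1)).toNat ≤ cycHeight π i := by
  have hm : i + 1 ∈ Icc 1 n := by simp; omega
  have hp := word_mem π⁻¹ hm
  have hw : word π (word π⁻¹ (i + 1)) = i + 1 := word_word_inv π (by omega) (by omega)
  rw [side, hw]
  by_cases h : word π⁻¹ (i + 1) < i + 1
  · rw [if_pos ((mem_Ep π).2 ⟨hp, by rwa [hw]⟩), decide_eq_true h, Bool.toNat_true,
      Nat.succ_le_iff, cycHeight]
    refine card_lt_card ?_
    rw [Finset.ssubset_iff_of_subset]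
    · refine ⟨word π⁻¹ (i + 1), ?_, by simp⟩
      rw [mem_filter, hw]
      exact ⟨hp, by omega, by omega⟩
    · intro j hj
      simp only [mem_filter, mem_Ep] at hj ⊢
      exact ⟨hj.1.1, by omega, by omega⟩
  · rw [if_neg fun h' => h (by have := ((mem_Ep π).1 h').2; rwa [hw] at this), decide_eq_false h,
      Bool.toNat_false, Nat.add_zero,
      ← card_cross_left]
    refine card_le_card fun j hj => ?_
    simp only [mem_filter, mem_Nep] at hj ⊢
    exact ⟨hj.1.1, by omega, by omega⟩

lemma valid_cycHist : Valid (cycHist π) :=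
  valid_hist (cycHeight_zero π) (cycHeight_step π) (side_add_le π)

lemma length_cycHist : (cycHist π).length = n := length_hist ..

lemma lht_cycHist : lht (cycHist π) = 0 := by
  rw [cycHist, lht_hist (cycHeight_zero π) (cycHeight_step π) n le_rfl, cycHeight_last]

/-! ### Cyclic statistics read off the history -/

lemma exc_eq_card : exc π = #(Ep π) :=
  card_image_of_injOn fun _ hi _ hj h =>
    word_inj π (mem_Ep π |>.1 hi).1 (mem_Ep π |>.1 hj).1 h

lemma ebot_eq_sum : ebot π = ∑ i ∈ Ep π, i := by simp [ebot, Ebot]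

lemma edif_eq_sum : edif π = ∑ i ∈ Ep π, (word π i - i) := by simp [edif, Edif]

lemma ine_eq_sum : ine π = ∑ i ∈ Icc 1 n, side π i := by simp [ine, Ine]

lemma ldes_cycHist : ldes (cycHist π) = exc π := by
  rw [cycHist, ldes_hist, exc_eq_card, Ep, card_filter]
  refine sum_congr rfl fun i _ => ?_
  by_cases h : i < word π i <;> simp [h]

lemma lbot_cycHist : lbot (cycHist π) = ebot π := by
  rw [cycHist, lbot_hist, ebot_eq_sum, Ep, sum_filter]
  simp

lemma lsum_cycHist : lsum (cycHist π) = ine π := by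
  rw [cycHist, lsum_hist, ine_eq_sum, sum_word π⁻¹ (side π)]

lemma ldif_cycHist : ldif (cycHist π) = edif π := by
  rw [cycHist, ldif_hist (cycHeight_zero π) (cycHeight_step π), edif_eq_sum, Ep, sum_filter]
  simp only [cycHeight, card_filter]
  rw [sum_comm]
  refine sum_congr rfl fun j hj => ?_
  have hw := word_mem π hj
  rw [mem_Icc] at hj hw
  rw [← card_filter]
  have : ({i ∈ Icc 1 n | j ≤ i ∧ i < word π j} : Finset ℕ) = Ico j (word π j) := by
    ext i
    simp only [mem_filter, mem_Icc, mem_Ico]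
    omega
  rw [this, Nat.card_Ico]
  split_ifs <;> omega

variable {π}

/-! ### Recovering a permutation from its excedance history -/

lemma word_mem_image_iff {S : Finset ℕ} (hS : S ⊆ Icc 1 n) {v : ℕ} (hv : v ∈ Icc 1 n) :
    v ∈ S.image (word π) ↔ word π⁻¹ v ∈ S := by
  rw [mem_image]
  constructor
  · rintro ⟨i, hi, rfl⟩
    rwa [(word_inv_eq_iff (hS hi) hv).2 rfl]
  · intro h
    exact ⟨_, h, word_word_inv π (mem_Icc.1 hv).1 (mem_Icc.1 hv).2⟩

lemma image_word_subset {S : Finset ℕ} (hS : S ⊆ Icc 1 n) : S.image (word π) ⊆ Icc 1 n :=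
  image_subset_iff.2 fun _ hi => word_mem π (hS hi)

/-- The bottoms give the excedance positions, the tops the excedance letters, and the side numbers
are inversion tables of the two subwords. -/
theorem cycHist_injective : Function.Injective (cycHist (n := n)) := by
  intro π σ h
  have h := hist_inj h
  have hE : Ep π = Ep σ := by
    ext i
    rw [mem_Ep, mem_Ep]
    refine and_congr_right fun hi => ?_
    have := (h i (mem_Icc.1 hi).1 (mem_Icc.1 hi).2).1
    simpa using this
  have hN : Nep π = Nep σ := by
    ext i
    rw [mem_Nep, mem_Nep]
    refine and_congr_right fun hi => ?_
    have := (h i (mem_Icc.1 hi).1 (mem_Icc.1 hi).2).1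
    rw [← not_lt, ← not_lt, not_iff_not]
    simpa using this
  have hEs : Ep π ⊆ Icc 1 n := filter_subset _ _
  have hNs : Nep π ⊆ Icc 1 n := filter_subset _ _
  have hinv : ∀ v ∈ Icc 1 n, (word π⁻¹ v < v ↔ word σ⁻¹ v < v) := by
    intro v hv
    have := (h v (mem_Icc.1 hv).1 (mem_Icc.1 hv).2).2.1
    simpa using this
  have hside : ∀ x ∈ Icc 1 n, ∀ y ∈ Icc 1 n, word π x = word σ y → side π x = side σ y := by
    intro x hx y hy hxy
    have hv := word_mem π hx
    have := (h _ (mem_Icc.1 hv).1 (mem_Icc.1 hv).2).2.2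
    rwa [(word_inv_eq_iff hx hv).2 rfl, (word_inv_eq_iff hy hv).2 hxy.symm] at this
  have hEimg : (Ep π).image (word π) = (Ep π).image (word σ) := by
    ext v
    by_cases hv : v ∈ Icc 1 n
    · rw [word_mem_image_iff hEs hv, word_mem_image_iff hEs hv]
      nth_rewrite 2 [hE]
      have := hinv v hv
      rw [mem_Ep, mem_Ep, word_word_inv π (mem_Icc.1 hv).1 (mem_Icc.1 hv).2,
        word_word_inv σ (mem_Icc.1 hv).1 (mem_Icc.1 hv).2]
      simp only [word_mem π⁻¹ hv, word_mem σ⁻¹ hv, this]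
    · exact ⟨fun h => (hv (image_word_subset hEs h)).elim,
        fun h => (hv (image_word_subset hEs h)).elim⟩
  have hNimg : (Nep π).image (word π) = (Nep π).image (word σ) := by
    ext v
    by_cases hv : v ∈ Icc 1 n
    · rw [word_mem_image_iff hNs hv, word_mem_image_iff hNs hv]
      nth_rewrite 2 [hN]
      have := hinv v hv
      rw [mem_Nep, mem_Nep, word_word_inv π (mem_Icc.1 hv).1 (mem_Icc.1 hv).2,
        word_word_inv σ (mem_Icc.1 hv).1 (mem_Icc.1 hv).2]
      simp only [word_mem π⁻¹ hv, word_mem σ⁻¹ hv, true_and, ← not_lt, this]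
    · exact ⟨fun h => (hv (image_word_subset hNs h)).elim,
        fun h => (hv (image_word_subset hNs h)).elim⟩
  have hNside : ∀ x ∈ Nep π, ∀ y ∈ Nep π, word π x = word σ y →
      #{j ∈ Nep π | x < j ∧ word π j < word π x} = #{j ∈ Nep π | y < j ∧ word σ j < word σ y} := by
    intro x hx y hy hxy
    have h1 := hside x (hNs hx) y (hNs hy) hxy
    have hx' := (mem_Nep π).1 hx
    have hy' := (mem_Nep σ).1 (hN ▸ hy)
    rw [side, side, if_neg (fun h => by rw [mem_Ep] at h; omega),
      if_neg (fun h => by rw [mem_Ep] at h; omega), ← hN] at h1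
    exact h1
  have key1 := eqOn_of_card_inversions_eq (S := Ep π) (f := word π) (g := word σ)
    (fun x hx y hy => word_inj π (hEs hx) (hEs hy)) (fun x hx y hy => word_inj σ (hEs hx) (hEs hy))
    hEimg (fun x hx y hy hxy => by
      have h1 := hside x (hEs hx) y (hEs hy) hxy
      rwa [side, side, if_pos hx, if_pos (hE ▸ hy), ← hE] at h1)
  -- Reversing both orders turns smaller letters to the right into larger letters to the left.
  have key2 := eqOn_of_card_inversions_eq (α := ℕᵒᵈ) (β := ℕᵒᵈ) (S := Nep π) (f := word π)
    (g := word σ)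
    (fun x hx y hy => word_inj π (hNs hx) (hNs hy)) (fun x hx y hy => word_inj σ (hNs hx) (hNs hy))
    hNimg hNside
  refine word_ext fun i hi => ?_
  by_cases hlt : i < word π i
  · exact key1 i ((mem_Ep π).2 ⟨hi, hlt⟩)
  · exact key2 i ((mem_Nep π).2 ⟨hi, not_lt.1 hlt⟩)

theorem map_cycHist : (univ : Finset (Equiv.Perm (Fin n))).val.map cycHist = paths n 0 :=
  map_univ_eq_paths cycHist cycHist_injective valid_cycHist length_cycHist lht_cycHist

end Cyclic

/-! ### The history of a permutation, read off its descents -/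

section Linear

variable {n : ℕ} (π : Equiv.Perm (Fin n))

/-- The letter `v` is a descent bottom. -/
def IsBot (v : ℕ) : Prop := v < word π (word π⁻¹ v - 1)

/-- The letter `v` is a descent top. -/
def IsTop (v : ℕ) : Prop := word π⁻¹ v < n ∧ word π (word π⁻¹ v + 1) < v

instance : DecidablePred (IsBot π) := fun _ => inferInstanceAs (Decidable (_ < _))

instance : DecidablePred (IsTop π) := fun _ => inferInstanceAs (Decidable (_ ∧ _))

/-- The number of descents to the right of the letter `v` that embrace `v`. -/
def rightEmbrace (v : ℕ) : ℕ :=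
  #{j ∈ Ico 1 n | word π⁻¹ v < j ∧ word π (j + 1) < v ∧ v < word π j}

/-- The number of descents across the gap between the letters `i` and `i + 1`. -/
def linHeight (i : ℕ) : ℕ := #{j ∈ Ico 1 n | word π (j + 1) ≤ i ∧ i < word π j}

/-- The history of a permutation with respect to its descents. -/
def linHist : List Step :=
  hist (fun v => decide (IsBot π v)) (fun v => decide (IsTop π v)) (rightEmbrace π) n

-- Because of this default value the first letter of the word is never a descent bottom.
@[simp] lemma word_zero : word π 0 = 0 := dif_neg (by omega)

lemma linHeight_zero : linHeight π 0 = 0 := by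
  rw [linHeight, card_eq_zero, filter_eq_empty_iff]
  intro j hj
  rw [mem_Ico] at hj
  have := one_le_word π (i := j + 1) (by omega) (by omega)
  omega

lemma linHeight_last : linHeight π n = 0 := by
  rw [linHeight, card_eq_zero, filter_eq_empty_iff]
  intro j hj
  rw [mem_Ico] at hj
  have := word_le π (i := j) (by omega) (by omega)
  omega

variable {π}

lemma card_filter_bot {v : ℕ} (hv : v ∈ Icc 1 n) :
    #{j ∈ Ico 1 n | word π (j + 1) = v ∧ v < word π j} = (decide (IsBot π v)).toNat := by
  have hp := word_mem π⁻¹ hv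
  rw [mem_Icc] at hp
  have key : ∀ j ∈ Ico 1 n, word π (j + 1) = v ↔ word π⁻¹ v = j + 1 := fun j hj => by
    rw [mem_Ico] at hj
    exact (word_inv_eq_iff (by simp; omega) hv).symm
  by_cases h : IsBot π v
  · have h1 : word π⁻¹ v ≠ 1 := by
      intro h1
      rw [IsBot, h1, Nat.sub_self, word_zero] at h
      omega
    rw [decide_eq_true h, Bool.toNat_true, card_eq_one]
    refine ⟨word π⁻¹ v - 1, ?_⟩
    ext j
    simp only [mem_filter, mem_singleton]
    constructor
    · rintro ⟨hj, hj', -⟩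
      rw [key j hj] at hj'
      omega
    · rintro rfl
      have hj : word π⁻¹ v - 1 ∈ Ico 1 n := by rw [mem_Ico]; omega
      exact ⟨hj, by rw [key _ hj]; omega, h⟩
  · rw [decide_eq_false h, Bool.toNat_false, card_eq_zero, filter_eq_empty_iff]
    rintro j hj ⟨h1, h2⟩
    rw [key j hj] at h1
    exact h (by rwa [IsBot, h1, Nat.add_sub_cancel])

lemma card_filter_top {v : ℕ} (hv : v ∈ Icc 1 n) :
    #{j ∈ Ico 1 n | word π j = v ∧ word π (j + 1) < v} = (decide (IsTop π v)).toNat := by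
  have hp := word_mem π⁻¹ hv
  rw [mem_Icc] at hp
  have key : ∀ j ∈ Ico 1 n, word π j = v ↔ word π⁻¹ v = j := fun j hj => by
    rw [mem_Ico] at hj
    exact (word_inv_eq_iff (by simp; omega) hv).symm
  by_cases h : IsTop π v
  · rw [decide_eq_true h, Bool.toNat_true, card_eq_one]
    refine ⟨word π⁻¹ v, ?_⟩
    ext j
    simp only [mem_filter, mem_singleton]
    constructor
    · rintro ⟨hj, hj', -⟩
      rw [key j hj] at hj'
      omega
    · rintro rfl
      have hj : word π⁻¹ v ∈ Ico 1 n := by rw [mem_Ico]; exact ⟨hp.1, h.1⟩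
      exact ⟨hj, by rw [key _ hj], h.2⟩
  · rw [decide_eq_false h, Bool.toNat_false, card_eq_zero, filter_eq_empty_iff]
    rintro j hj ⟨h1, h2⟩
    rw [key j hj] at h1
    exact h ⟨by rw [mem_Ico] at hj; omega, by rwa [h1]⟩

variable (π)

lemma linHeight_step (i : ℕ) (hi : i < n) :
    linHeight π i + (decide (IsBot π (i + 1))).toNat
      = linHeight π (i + 1) + (decide (IsTop π (i + 1))).toNat := by
  have hm : i + 1 ∈ Icc 1 n := by simp; omega
  rw [← card_filter_bot hm, ← card_filter_top hm, linHeight, linHeight, card_filter, card_filter,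
    card_filter, card_filter, ← sum_add_distrib, ← sum_add_distrib]
  refine sum_congr rfl fun j hj => ?_
  split_ifs <;> omega

/-- The number of descents across the gap above `i` that start at the position `x` or later. -/
def linHeightFrom (i x : ℕ) : ℕ := #{j ∈ Ico 1 n | x ≤ j ∧ word π (j + 1) ≤ i ∧ i < word π j}

/-- A descent starting to the right of the letter `i + 1` crosses the gap below `i + 1` exactly when
it embraces that letter; a descent starting at the letter itself crosses the gap and accounts for
the top. -/
lemma rightEmbrace_add (i : ℕ) (hi : i < n) :
    rightEmbrace π (i + 1) + (decide (IsTop π (i + 1))).toNat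
      = linHeightFrom π i (word π⁻¹ (i + 1)) := by
  have hm : i + 1 ∈ Icc 1 n := by simp; omega
  rw [← card_filter_top hm, rightEmbrace, linHeightFrom, card_filter, card_filter, card_filter,
    ← sum_add_distrib]
  refine sum_congr rfl fun j hj => ?_
  have hj' : j ∈ Icc 1 n := by rw [mem_Ico] at hj; rw [mem_Icc]; omega
  have h1 := word_inv_eq_iff (π := π) hj' hm
  split_ifs <;> omega

lemma linHeightFrom_le (i x : ℕ) : linHeightFrom π i x ≤ linHeight π i := by
  refine card_le_card fun j hj => ?_
  simp only [mem_filter] at hj ⊢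
  exact ⟨hj.1, hj.2.2⟩

lemma valid_linHist : Valid (linHist π) :=
  valid_hist (linHeight_zero π) (linHeight_step π) fun i hi => by
    rw [rightEmbrace_add π i hi]
    exact linHeightFrom_le π i _

lemma length_linHist : (linHist π).length = n := length_hist ..

lemma lht_linHist : lht (linHist π) = 0 := by
  rw [linHist, lht_hist (linHeight_zero π) (linHeight_step π) n le_rfl, linHeight_last]

/-! #### Statistics -/

lemma sum_bot (f : ℕ → ℕ) :
    (∑ v ∈ Icc 1 n, if IsBot π v then f v else 0) = ∑ j ∈ Des π, f (word π (j + 1)) := by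
  have h1 : ∀ v ∈ Icc 1 n, (if IsBot π v then f v else 0)
      = ∑ j ∈ Ico 1 n, if word π (j + 1) = v ∧ v < word π j then f v else 0 := by
    intro v hv
    rw [← sum_filter, sum_const, card_filter_bot hv]
    by_cases h : IsBot π v <;> simp [h]
  rw [sum_congr rfl h1, sum_comm, Des, sum_filter]
  refine sum_congr rfl fun j hj => ?_
  rw [mem_Ico] at hj
  have hm := word_mem π (i := j + 1) (by rw [mem_Icc]; omega)
  rw [sum_eq_single_of_mem _ hm]
  · simp
  · intro v _ hv
    exact if_neg fun h => hv h.1.symm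

lemma dbot_eq_sum : dbot π = ∑ j ∈ Des π, word π (j + 1) := by simp [dbot, Dbot]

lemma ddif_eq_sum : ddif π = ∑ j ∈ Des π, (word π j - word π (j + 1)) := by simp [ddif, Ddif]

lemma ldes_linHist : ldes (linHist π) = des π := by
  rw [linHist, ldes_hist, des, card_eq_sum_ones, ← sum_bot π fun _ => 1]
  refine sum_congr rfl fun i _ => ?_
  by_cases h : IsBot π i <;> simp [h]

lemma lbot_linHist : lbot (linHist π) = dbot π := by
  rw [linHist, lbot_hist, dbot_eq_sum, ← sum_bot π fun v => v]
  simp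

lemma lsum_linHist : lsum (linHist π) = pat2_31 π := by
  rw [linHist, lsum_hist, ← sum_word π, pat2_31, card_filter, sum_product]
  refine sum_congr rfl fun i hi => ?_
  rw [rightEmbrace, card_filter, word_inv_word π (mem_Icc.1 hi).1 (mem_Icc.1 hi).2]

lemma ldif_linHist : ldif (linHist π) = ddif π := by
  rw [linHist, ldif_hist (linHeight_zero π) (linHeight_step π), ddif_eq_sum, Des, sum_filter]
  simp only [linHeight, card_filter]
  rw [sum_comm]
  refine sum_congr rfl fun j hj => ?_
  rw [mem_Ico] at hj
  have h1 := word_le π (i := j) (by omega) (by omega)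
  have h2 := one_le_word π (i := j + 1) (by omega) (by omega)
  rw [← card_filter]
  have : ({i ∈ Icc 1 n | word π (j + 1) ≤ i ∧ i < word π j} : Finset ℕ)
      = Ico (word π (j + 1)) (word π j) := by
    ext i
    simp only [mem_filter, mem_Icc, mem_Ico]
    omega
  rw [this, Nat.card_Ico]
  split_ifs <;> omega

/-- For each descent, every letter strictly between its bottom and its top stands to its left or to
its right; there are one fewer of them than the size of the drop. -/
lemma pat2_31_add_pat31_2_add_des : pat2_31 π + pat31_2 π + des π = ddif π := by
  rw [pat2_31, pat31_2, des, Des, ddif_eq_sum, Des, card_filter, card_filter, card_filter,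
    sum_product, sum_product, sum_comm, ← sum_add_distrib, ← sum_add_distrib, sum_filter]
  refine sum_congr rfl fun j hj => ?_
  rw [mem_Ico] at hj
  have h1 := word_le π (i := j) (by omega) (by omega)
  have h2 := one_le_word π (i := j + 1) (by omega) (by omega)
  have h3 : (∑ i ∈ Icc 1 n, if word π (j + 1) < word π i ∧ word π i < word π j then 1 else 0)
      = word π j - word π (j + 1) - 1 := by
    rw [sum_word π fun v => if word π (j + 1) < v ∧ v < word π j then 1 else 0, ← card_filter]
    have : ({i ∈ Icc 1 n | word π (j + 1) < i ∧ i < word π j} : Finset ℕ)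
        = Ioo (word π (j + 1)) (word π j) := by
      ext i
      simp only [mem_filter, mem_Icc, mem_Ioo]
      omega
    rw [this, Nat.card_Ioo]
  rw [← sum_add_distrib]
  have h4 : ∀ i ∈ Icc 1 n,
      ((if i < j ∧ word π (j + 1) < word π i ∧ word π i < word π j then 1 else 0)
        + if j + 1 < i ∧ word π (j + 1) < word π i ∧ word π i < word π j then 1 else 0)
      = if word π (j + 1) < word π i ∧ word π i < word π j then 1 else 0 := by
    intro i hi
    have h5 : i = j → word π i = word π j := fun h => by rw [h]
    have h6 : i = j + 1 → word π i = word π (j + 1) := fun h => by rw [h]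
    split_ifs <;> omega
  rw [sum_congr rfl h4, h3]
  split_ifs <;> omega

/-! #### A permutation is determined by its history -/

/-- The letters up to `i` that follow a letter above `i` and stand to the right of `x`. -/
def starts (i x : ℕ) : Finset ℕ := {w ∈ Icc 1 i | i < word π (word π⁻¹ w - 1) ∧ x < word π⁻¹ w}

/-- A descent across the gap corresponds to its bottom. Thus the weight and the top bit of a step
tell how many starts lie to the right of the new letter. -/
lemma card_starts {i : ℕ} (hi : i ≤ n) (x : ℕ) : #(starts π i x) = linHeightFrom π i x := by
  refine card_nbij' (fun w => word π⁻¹ w - 1) (fun j => word π (j + 1)) ?_ ?_ ?_ ?_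
  · intro w hw
    simp only [starts, coe_filter, mem_Icc, Set.mem_ofPred_eq] at hw
    obtain ⟨⟨h1, h2⟩, h3, h4⟩ := hw
    have hp := word_mem π⁻¹ (i := w) (by rw [mem_Icc]; omega)
    have h5 : word π⁻¹ w ≠ 1 := by
      intro h5
      rw [h5, Nat.sub_self, word_zero] at h3
      omega
    rw [mem_Icc] at hp
    have h6 : word π⁻¹ w - 1 + 1 = word π⁻¹ w := by omega
    simp only [coe_filter, Set.mem_ofPred_eq, mem_Ico]
    rw [h6, word_word_inv π h1 (by omega)]
    omega
  · intro j hj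
    simp only [coe_filter, mem_Ico, Set.mem_ofPred_eq] at hj
    have h1 := one_le_word π (i := j + 1) (by omega) (by omega)
    simp only [starts, coe_filter, mem_Icc, Set.mem_ofPred_eq]
    rw [word_inv_word π (by omega) (by omega), Nat.add_sub_cancel]
    omega
  · intro w hw
    simp only [starts, coe_filter, mem_Icc, Set.mem_ofPred_eq] at hw
    have hp := one_le_word π⁻¹ (i := w) (by omega) (by omega)
    simp only
    rw [Nat.sub_add_cancel hp, word_word_inv π (by omega) (by omega)]
  · intro j hj
    simp only [coe_filter, mem_Ico, Set.mem_ofPred_eq] at hj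
    simp only
    rw [word_inv_word π (by omega) (by omega), Nat.add_sub_cancel]

lemma exists_start {i u x : ℕ} (hi : i ≤ n) (hu : 1 ≤ u) (hui : u ≤ i) (hx : i < word π x)
    (hxu : x < word π⁻¹ u) : ∃ w ∈ starts π i x, word π⁻¹ w ≤ word π⁻¹ u := by
  -- The start sought is the first letter up to `i` after position `x`.
  have hex : ∃ q, x < q ∧ word π q ≤ i :=
    ⟨word π⁻¹ u, hxu, by rw [word_word_inv π hu (by omega)]; exact hui⟩
  classical
  have hq := Nat.find_spec hex
  have hmin := fun m => Nat.find_min hex (m := m)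
  have hle : Nat.find hex ≤ word π⁻¹ u :=
    Nat.find_min' hex ⟨hxu, by rw [word_word_inv π hu (by omega)]; exact hui⟩
  have hp := word_le π⁻¹ (i := u) hu (by omega)
  set q := Nat.find hex
  have h1 := one_le_word π (i := q) (by omega) (by omega)
  have h2 := word_inv_word π (i := q) (by omega) (by omega)
  refine ⟨word π q, ?_, by rwa [h2]⟩
  simp only [starts, mem_filter, mem_Icc, h2]
  refine ⟨⟨h1, hq.2⟩, ?_, hq.1⟩
  by_cases hqx : q - 1 = x
  · rwa [hqx]
  · have := hmin (q - 1) (by omega)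
    omega

/-- If `i + 1` stands left of `u`, some start lies between them or at `u`, and it counts for `i + 1`
only. So counting starts locates `i + 1` among the smaller letters. -/
lemma word_inv_lt_iff {i u : ℕ} (hi : i < n) (hu : 1 ≤ u) (hui : u ≤ i) :
    word π⁻¹ u < word π⁻¹ (i + 1) ↔
      #(starts π i (word π⁻¹ (i + 1))) ≤ #(starts π i (word π⁻¹ u)) := by
  constructor
  · intro h
    refine card_le_card fun w hw => ?_
    simp only [starts, mem_filter] at hw ⊢
    exact ⟨hw.1, hw.2.1, by omega⟩
  · intro h
    by_contra hc
    have hne : word π⁻¹ u ≠ word π⁻¹ (i + 1) := fun he => by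
      have := word_inj π⁻¹ (i := u) (j := i + 1) (by rw [mem_Icc]; omega)
          (by rw [mem_Icc]; omega) he
      omega
    obtain ⟨w, hw, hwu⟩ := exists_start π (x := word π⁻¹ (i + 1)) hi.le hu hui
      (by rw [word_word_inv π (by omega) (by omega)]; omega) (by omega)
    refine absurd h (not_le.2 (card_lt_card ?_))
    rw [Finset.ssubset_iff_of_subset]
    · refine ⟨w, hw, fun hw' => ?_⟩
      simp only [starts, mem_filter] at hw'
      omega
    · intro w hw
      simp only [starts, mem_filter] at hw ⊢
      exact ⟨hw.1, hw.2.1, by omega⟩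

/-- A descent top is followed at once by a smaller letter, which must be the first smaller letter to
its right. This tells which letter ceases to be a start when `i + 1` joins the small letters. -/
lemma word_pred_eq_iff {i w : ℕ} (hi : i < n) (hw : 1 ≤ w) (hwi : w ≤ i) :
    word π (word π⁻¹ w - 1) = i + 1 ↔ IsTop π (i + 1) ∧ word π⁻¹ (i + 1) < word π⁻¹ w ∧
      ∀ u, 1 ≤ u → u ≤ i → word π⁻¹ (i + 1) < word π⁻¹ u → ¬ word π⁻¹ u < word π⁻¹ w := by
  have hp := word_mem π⁻¹ (i := w) (by rw [mem_Icc]; omega)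
  have hq := word_mem π⁻¹ (i := i + 1) (by rw [mem_Icc]; omega)
  rw [mem_Icc] at hp hq
  constructor
  · intro h
    have h1 : word π⁻¹ w ≠ 1 := by
      intro h1
      rw [h1, Nat.sub_self, word_zero] at h
      omega
    have h2 : word π⁻¹ (i + 1) = word π⁻¹ w - 1 := by
      rw [← h, word_inv_word π (by omega) (by omega)]
    refine ⟨⟨by omega, ?_⟩, by omega, fun u _ _ hu => by omega⟩
    rw [h2, Nat.sub_add_cancel hp.1, word_word_inv π hw (by omega)]
    omega
  · rintro ⟨⟨h1, h2⟩, h3, h4⟩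
    have h5 := one_le_word π (i := word π⁻¹ (i + 1) + 1) (by omega) (by omega)
    have h6 := word_inv_word π (i := word π⁻¹ (i + 1) + 1) (by omega) (by omega)
    have h7 := h4 _ h5 (by omega) (by omega)
    have h8 : word π⁻¹ w - 1 = word π⁻¹ (i + 1) := by omega
    rw [h8, word_word_inv π (by omega) (by omega)]

variable {π}

/-- The letters are inserted in increasing order. The induction has to carry, besides their relative
order, the information which of them are starts, as the next weight refers to it. -/
lemma linHist_determines {σ : Equiv.Perm (Fin n)} (h : linHist π = linHist σ) (i : ℕ) (hi : i ≤ n) :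
    (∀ u w, 1 ≤ u → u ≤ i → 1 ≤ w → w ≤ i →
      (word π⁻¹ u < word π⁻¹ w ↔ word σ⁻¹ u < word σ⁻¹ w)) ∧
    ∀ w, 1 ≤ w → w ≤ i → (i < word π (word π⁻¹ w - 1) ↔ i < word σ (word σ⁻¹ w - 1)) := by
  induction i with
  | zero => exact ⟨fun u w h1 h2 => by omega, fun w h1 h2 => by omega⟩
  | succ i ih =>
    obtain ⟨ih1, ih2⟩ := ih (by omega)
    obtain ⟨hb, ht, hs⟩ := hist_inj h (i + 1) (by omega) hi
    have hcv : #(starts π i (word π⁻¹ (i + 1))) = #(starts σ i (word σ⁻¹ (i + 1))) := by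
      rw [card_starts π (by omega), card_starts σ (by omega), ← rightEmbrace_add π i hi,
        ← rightEmbrace_add σ i hi, hs, ht]
    have hcu : ∀ u, 1 ≤ u → u ≤ i → #(starts π i (word π⁻¹ u)) = #(starts σ i (word σ⁻¹ u)) := by
      intro u hu hui
      rw [starts, starts]
      refine congrArg card (filter_congr fun w hw => ?_)
      rw [mem_Icc] at hw
      rw [ih1 u w hu hui hw.1 hw.2, ih2 w hw.1 hw.2]
    have hlt : ∀ u, 1 ≤ u → u ≤ i →
        (word π⁻¹ u < word π⁻¹ (i + 1) ↔ word σ⁻¹ u < word σ⁻¹ (i + 1)) := by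
      intro u hu hui
      rw [word_inv_lt_iff π hi hu hui, word_inv_lt_iff σ hi hu hui, hcv, hcu u hu hui]
    have hne : ∀ (τ : Equiv.Perm (Fin n)) u, 1 ≤ u → u ≤ i → word τ⁻¹ u ≠ word τ⁻¹ (i + 1) := by
      intro τ u hu hui he
      have := word_inj τ⁻¹ (i := u) (j := i + 1) (by rw [mem_Icc]; omega)
          (by rw [mem_Icc]; omega) he
      omega
    have hgt : ∀ u, 1 ≤ u → u ≤ i →
        (word π⁻¹ (i + 1) < word π⁻¹ u ↔ word σ⁻¹ (i + 1) < word σ⁻¹ u) := by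
      intro u hu hui
      have := hlt u hu hui
      have := hne π u hu hui
      have := hne σ u hu hui
      omega
    refine ⟨fun u w hu hui hw hwi => ?_, fun w hw hwi => ?_⟩
    · rcases Nat.lt_or_ge u (i + 1) with h1 | h1 <;> rcases Nat.lt_or_ge w (i + 1) with h2 | h2
      · exact ih1 u w hu (by omega) hw (by omega)
      · obtain rfl : w = i + 1 := by omega
        exact hlt u hu (by omega)
      · obtain rfl : u = i + 1 := by omega
        exact hgt w hw (by omega)
      · obtain rfl : w = i + 1 := by omega
        obtain rfl : u = i + 1 := by omega
        simp
    · rcases Nat.lt_or_ge w (i + 1) with h2 | h2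
      · have e1 := ih2 w hw (by omega)
        have e2 : word π (word π⁻¹ w - 1) = i + 1 ↔ word σ (word σ⁻¹ w - 1) = i + 1 := by
          have ht' : IsTop π (i + 1) ↔ IsTop σ (i + 1) := by simpa using ht
          rw [word_pred_eq_iff π hi hw (by omega), word_pred_eq_iff σ hi hw (by omega), ht',
            hgt w hw (by omega)]
          refine and_congr_right fun _ => and_congr_right fun _ => ?_
          refine forall_congr' fun u => forall_congr' fun hu => forall_congr' fun hui => ?_
          rw [hgt u hu hui, ih1 u w hu hui hw (by omega)]
        omega
      · obtain rfl : w = i + 1 := by omega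
        exact decide_eq_decide.1 hb

/-- The relative order of all letters gives their positions, by counting the letters further left.
-/
theorem linHist_injective : Function.Injective (linHist (n := n)) := by
  intro π σ h
  have hlt := (linHist_determines h n le_rfl).1
  have hcard : ∀ (τ : Equiv.Perm (Fin n)), ∀ u ∈ Icc 1 n,
      #{w ∈ Icc 1 n | word τ⁻¹ w < word τ⁻¹ u} = word τ⁻¹ u - 1 := by
    intro τ u hu
    have hp := word_mem τ⁻¹ hu
    rw [mem_Icc] at hp
    rw [card_filter, sum_word τ⁻¹ fun p => if p < word τ⁻¹ u then 1 else 0, ← card_filter]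
    have : ({p ∈ Icc 1 n | p < word τ⁻¹ u} : Finset ℕ) = Ico 1 (word τ⁻¹ u) := by
      ext p
      simp only [mem_filter, mem_Icc, mem_Ico]
      omega
    rw [this, Nat.card_Ico]
  have : π⁻¹ = σ⁻¹ := word_ext fun u hu => by
    have h1 := hcard π u hu
    have h2 := hcard σ u hu
    have h3 : #{w ∈ Icc 1 n | word π⁻¹ w < word π⁻¹ u}
        = #{w ∈ Icc 1 n | word σ⁻¹ w < word σ⁻¹ u} := by
      refine congrArg card (filter_congr fun w hw => ?_)
      rw [mem_Icc] at hw hu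
      exact hlt w u hw.1 hw.2 hu.1 hu.2
    have hp := word_mem π⁻¹ hu
    have hq := word_mem σ⁻¹ hu
    rw [mem_Icc] at hp hq
    omega
  exact inv_injective this

theorem map_linHist : (univ : Finset (Equiv.Perm (Fin n))).val.map linHist = paths n 0 :=
  map_univ_eq_paths linHist linHist_injective valid_linHist length_linHist lht_linHist

end Linear

/-! ### Equidistribution -/

/-- Two statistics on the permutations of `{1, …, n}` take each value equally often. -/
def Equidist {n : ℕ} (f g : Equiv.Perm (Fin n) → ℤ) : Prop :=
  ∀ k : ℤ, #{π | f π = k} = #{π | g π = k}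

section Equidist

variable {n : ℕ} {f g h : Equiv.Perm (Fin n) → ℤ}

lemma Equidist.trans (h1 : Equidist f g) (h2 : Equidist g h) : Equidist f h :=
  fun k => (h1 k).trans (h2 k)

lemma Equidist.symm (h1 : Equidist f g) : Equidist g f := fun k => (h1 k).symm

lemma equidist_of_injective {φ : Equiv.Perm (Fin n) → Equiv.Perm (Fin n)}
    (hφ : Function.Injective φ) (hf : ∀ π, f (φ π) = g π) : Equidist f g := by
  intro k
  symm
  refine card_equiv (Equiv.ofBijective φ (Finite.injective_iff_bijective.1 hφ)) fun π => ?_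
  simp [hf]

lemma equidist_of_map_eq {D D' : Equiv.Perm (Fin n) → List Step}
    (hD : univ.val.map D = univ.val.map D') (F : List Step → ℤ) (hf : ∀ π, f π = F (D π))
    (hg : ∀ π, g π = F (D' π)) : Equidist f g := by
  intro k
  have h1 := congrArg (fun M => Multiset.card (Multiset.filter (fun l => F l = k) M)) hD
  simp only [Multiset.filter_map, Multiset.card_map, Function.comp_def] at h1
  simp only [hf, hg]
  exact h1

lemma exists_linHist_eq {l : List Step} (h1 : Valid l) (h2 : l.length = n) (h3 : lht l = 0) :
    ∃ π : Equiv.Perm (Fin n), linHist π = l := by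
  have h := mem_paths_of_valid l h1
  rw [h2, h3, ← map_linHist, Multiset.mem_map] at h
  obtain ⟨π, -, h⟩ := h
  exact ⟨π, h⟩

lemma exists_cycHist_eq {l : List Step} (h1 : Valid l) (h2 : l.length = n) (h3 : lht l = 0) :
    ∃ π : Equiv.Perm (Fin n), cycHist π = l := by
  have h := mem_paths_of_valid l h1
  rw [h2, h3, ← map_cycHist, Multiset.mem_map] at h
  obtain ⟨π, -, h⟩ := h
  exact ⟨π, h⟩

/-- Statistics related by an injection between encodings are equidistributed. -/
lemma equidist_of_related {T : Type*} {D D' : Equiv.Perm (Fin n) → T} {ι : T → T}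
    (hinj : ∀ π σ, ι (D π) = ι (D σ) → π = σ) (hex : ∀ π, ∃ σ, D' σ = ι (D π))
    (hfg : ∀ π σ, D' σ = ι (D π) → f σ = g π) : Equidist f g := by
  choose φ hφ using hex
  refine equidist_of_injective (φ := φ) (fun π σ h => hinj π σ ?_) fun π => hfg π _ (hφ π)
  rw [← hφ, ← hφ, h]

end Equidist

/-! ### Reversing the choices in a history -/

/-- Replace each weight by its complement. -/
def rev : List Step → List Step
  | [] => []
  | (b, t, s) :: l => (b, t, lht l - t.toNat - s) :: rev l

@[simp] lemma length_rev (l : List Step) : (rev l).length = l.length := by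
  induction l with
  | nil => rfl
  | cons x l ih => obtain ⟨b, t, s⟩ := x; simp [rev, ih]

@[simp] lemma lht_rev (l : List Step) : lht (rev l) = lht l := by
  induction l with
  | nil => rfl
  | cons x l ih => obtain ⟨b, t, s⟩ := x; simp [rev, lht, ih]

@[simp] lemma ldes_rev (l : List Step) : ldes (rev l) = ldes l := by
  induction l with
  | nil => rfl
  | cons x l ih => obtain ⟨b, t, s⟩ := x; simp [rev, ldes, ih]

@[simp] lemma lbot_rev (l : List Step) : lbot (rev l) = lbot l := by
  induction l with
  | nil => rfl
  | cons x l ih => obtain ⟨b, t, s⟩ := x; simp [rev, lbot, ih]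

@[simp] lemma ldif_rev (l : List Step) : ldif (rev l) = ldif l := by
  induction l with
  | nil => rfl
  | cons x l ih => obtain ⟨b, t, s⟩ := x; simp [rev, ldif, lht, ih]

lemma valid_rev {l : List Step} (hl : Valid l) : Valid (rev l) := by
  induction l with
  | nil => trivial
  | cons x l ih =>
    obtain ⟨b, t, s⟩ := x
    obtain ⟨h1, h2⟩ := hl
    refine ⟨ih h1, ?_⟩
    rw [lht_rev]
    omega

lemma rev_rev {l : List Step} (hl : Valid l) : rev (rev l) = l := by
  induction l with
  | nil => rfl
  | cons x l ih =>
    obtain ⟨b, t, s⟩ := x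
    obtain ⟨h1, h2⟩ := hl
    simp only [rev, lht_rev, ih h1, List.cons.injEq, Prod.mk.injEq, true_and, and_true]
    omega

/-- A weight and its complement add up to the number of arcs that stay open, which is the new height
less a possible bottom. -/
lemma lsum_rev {l : List Step} (hl : Valid l) : lsum (rev l) + lsum l + ldes l = ldif l := by
  induction l with
  | nil => rfl
  | cons x l ih =>
    obtain ⟨b, t, s⟩ := x
    obtain ⟨h1, h2⟩ := hl
    have := ih h1
    simp only [rev, lsum, ldes, ldif, lht]
    omega

lemma equidist_rev {n : ℕ} {f g : Equiv.Perm (Fin n) → ℤ}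
    (h : ∀ π σ : Equiv.Perm (Fin n), dbot σ = dbot π → ddif σ = ddif π → des σ = des π →
      pat2_31 σ = pat31_2 π → f σ = g π) : Equidist f g := by
  refine equidist_of_related (D := linHist) (D' := linHist) (ι := rev) (fun π σ he => ?_) (fun π =>
      ?_)
    fun π σ he => ?_
  · have := congrArg rev he
    rw [rev_rev (valid_linHist π), rev_rev (valid_linHist σ)] at this
    exact linHist_injective this
  · exact exists_linHist_eq (valid_rev (valid_linHist π)) (by rw [length_rev, length_linHist])
      (by rw [lht_rev, lht_linHist])
  · have h1 := congrArg lbot he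
    have h2 := congrArg ldif he
    have h3 := congrArg ldes he
    have h4 := congrArg lsum he
    have h5 := lsum_rev (valid_linHist π)
    have h6 := pat2_31_add_pat31_2_add_des π
    simp only [lbot_rev, ldif_rev, ldes_rev, lbot_linHist, ldif_linHist, ldes_linHist,
      lsum_linHist] at h1 h2 h3 h4 h5
    exact h π σ h1 h2 h3 (by omega)

/-! ### Inversions -/

section Inv

variable {n : ℕ} (π : Equiv.Perm (Fin n))

/-- Compare the `π(i) - 1` smaller letters with the `i - 1` positions to the left; the smaller
letters to the left belong to both. -/
lemma card_lt_and_word_lt {i : ℕ} (hi : i ∈ Icc 1 n) :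
    (∑ j ∈ Icc 1 n, if j < i ∧ word π i < word π j then 1 else 0) + word π i
      = (∑ j ∈ Icc 1 n, if i < j ∧ word π j < word π i then 1 else 0) + i := by
  have hcard : ∀ v ∈ Icc 1 n, (∑ j ∈ Icc 1 n, if j < v then 1 else 0) = v - 1 := by
    intro v hv
    rw [← card_filter]
    have : ({j ∈ Icc 1 n | j < v} : Finset ℕ) = Ico 1 v := by
      ext j
      rw [mem_Icc] at hv
      simp only [mem_filter, mem_Icc, mem_Ico]
      omega
    rw [this, Nat.card_Ico]
  have hw := word_mem π hi
  have h1 := hcard i hi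
  have h2 := hcard _ hw
  rw [← sum_word π fun v => if v < word π i then 1 else 0] at h2
  have h3 : (∑ j ∈ Icc 1 n, if j < i ∧ word π i < word π j then 1 else 0)
      + (∑ j ∈ Icc 1 n, if word π j < word π i then 1 else 0)
      = (∑ j ∈ Icc 1 n, if i < j ∧ word π j < word π i then 1 else 0)
      + ∑ j ∈ Icc 1 n, if j < i then 1 else 0 := by
    rw [← sum_add_distrib, ← sum_add_distrib]
    refine sum_congr rfl fun j hj => ?_
    have h4 := word_inj π hi hj
    have h5 : i = j → word π i = word π j := fun h => by rw [h]
    split_ifs <;> omega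
  rw [mem_Icc] at hi hw
  omega

lemma side_eq_sum (i : ℕ) (hi : i ∈ Icc 1 n) : side π i =
    ∑ j ∈ Icc 1 n, ((if i < word π i ∧ j < word π j ∧ j < i ∧ word π i < word π j then 1 else 0)
      + if word π i ≤ i ∧ word π j ≤ j ∧ i < j ∧ word π j < word π i then 1 else 0) := by
  rw [side]
  by_cases h : i < word π i
  · rw [if_pos ((mem_Ep π).2 ⟨hi, h⟩), Ep, filter_filter, card_filter]
    refine sum_congr rfl fun j _ => ?_
    split_ifs <;> omega
  · rw [if_neg fun h' => h ((mem_Ep π).1 h').2, Nep, filter_filter, card_filter]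
    refine sum_congr rfl fun j _ => ?_
    split_ifs <;> omega

/-- Count inversions by the larger letter. At an excedance, the smaller letters to the right number
`π(i) - i` plus the larger letters to the left, and the latter are excedances. At a non-excedance,
every smaller letter to the right is a non-excedance too. -/
lemma inv_eq_edif_add_ine : inv π = edif π + ine π := by
  have hE : edif π = ∑ i ∈ Icc 1 n, if i < word π i then word π i - i else 0 := by
    rw [edif_eq_sum, Ep, sum_filter]
  have h1 : edif π + ∑ i ∈ Icc 1 n, ∑ j ∈ Icc 1 n,
        (if i < word π i ∧ j < i ∧ word π i < word π j then 1 else 0)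
      = ∑ i ∈ Icc 1 n, ∑ j ∈ Icc 1 n,
        (if i < word π i ∧ i < j ∧ word π j < word π i then 1 else 0) := by
    rw [hE, ← sum_add_distrib]
    refine sum_congr rfl fun i hi => ?_
    by_cases h : i < word π i
    · have := card_lt_and_word_lt π hi
      simp only [h, true_and, if_true]
      omega
    · simp [h]
  have h2 : ine π = (∑ i ∈ Icc 1 n, ∑ j ∈ Icc 1 n,
        (if i < word π i ∧ j < i ∧ word π i < word π j then 1 else 0))
      + ∑ i ∈ Icc 1 n, ∑ j ∈ Icc 1 n,
        (if word π i ≤ i ∧ word π j ≤ j ∧ i < j ∧ word π j < word π i then 1 else 0) := by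
    rw [ine_eq_sum, ← sum_add_distrib]
    refine sum_congr rfl fun i hi => ?_
    rw [side_eq_sum π i hi, sum_add_distrib]
    congr 1
    refine sum_congr rfl fun j _ => ?_
    split_ifs <;> omega
  rw [inv, card_filter, sum_product, h2, ← Nat.add_assoc, h1, ← sum_add_distrib]
  refine sum_congr rfl fun i _ => ?_
  rw [← sum_add_distrib]
  refine sum_congr rfl fun j _ => ?_
  dsimp only
  split_ifs <;> omega

end Inv

/-! ### The statistics without last letter -/

section Unshifted

variable {n : ℕ}

lemma linHist_equidist_cycHist {f g : Equiv.Perm (Fin n) → ℤ} (F : List Step → ℤ)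
    (hf : ∀ π, f π = F (linHist π)) (hg : ∀ π, g π = F (cycHist π)) : Equidist f g :=
  equidist_of_map_eq (map_linHist.trans map_cycHist.symm) F hf hg

/-- The sole passage from bottoms to heights, through equality of generating functions instead of a
bijection. -/
lemma den_equidist_inv :
    Equidist (fun π : Equiv.Perm (Fin n) => (den π : ℤ)) fun π => (inv π : ℤ) := by
  intro k
  have h := card_lbot_eq_card_ldif cycHist (map_cycHist (n := n))
  simp only [lbot_cycHist, lsum_cycHist, ldif_cycHist, ← inv_eq_edif_add_ine] at h
  rcases lt_or_ge k 0 with hk | hk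
  · rw [filter_false_of_mem fun π _ => by dsimp only; omega,
      filter_false_of_mem fun π _ => by dsimp only; omega]
  · lift k to ℕ using hk
    simp only [den, Nat.cast_inj]
    exact h k

lemma mad_equidist_inv :
    Equidist (fun π : Equiv.Perm (Fin n) => (mad π : ℤ)) fun π => (inv π : ℤ) :=
  linHist_equidist_cycHist (fun l => ((ldif l + lsum l : ℕ) : ℤ))
    (fun π => by rw [ldif_linHist, lsum_linHist, mad])
    (fun π => by rw [ldif_cycHist, lsum_cycHist, inv_eq_edif_add_ine])

lemma mak_equidist_inv :
    Equidist (fun π : Equiv.Perm (Fin n) => (mak π : ℤ)) fun π => (inv π : ℤ) :=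
  .trans (linHist_equidist_cycHist (fun l => ((lbot l + lsum l : ℕ) : ℤ))
    (fun π => by rw [lbot_linHist, lsum_linHist, mak])
    (fun π => by rw [lbot_cycHist, lsum_cycHist, den])) den_equidist_inv

lemma makl_equidist_inv :
    Equidist (fun π : Equiv.Perm (Fin n) => (makl π : ℤ)) fun π => (inv π : ℤ) := by
  refine .trans (.symm (equidist_rev fun π σ h1 _ _ h4 => ?_)) mak_equidist_inv
  rw [mak, makl, h1, h4]

lemma madl_equidist_inv :
    Equidist (fun π : Equiv.Perm (Fin n) => (madl π : ℤ)) fun π => (inv π : ℤ) := by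
  refine .trans (.symm (equidist_rev fun π σ _ h2 _ h4 => ?_)) mad_equidist_inv
  rw [mad, madl, h2, h4]

/-- Eliminating 31-2 from `makl` by means of `ddif` leaves an expression in the history whose cyclic
reading is `fz3`. -/
lemma fz3_equidist_inv :
    Equidist (fun π : Equiv.Perm (Fin n) => fz3 π) fun π => (inv π : ℤ) := by
  refine .trans (.symm (linHist_equidist_cycHist
    (fun l => (lbot l + ldif l - ldes l - lsum l : ℤ)) (fun π => ?_) fun π => ?_)) makl_equidist_inv
  · have := pat2_31_add_pat31_2_add_des π
    rw [lbot_linHist, ldif_linHist, ldes_linHist, lsum_linHist, makl]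
    omega
  · rw [lbot_cycHist, ldif_cycHist, ldes_cycHist, lsum_cycHist, fz3]

lemma fz4_equidist_inv :
    Equidist (fun π : Equiv.Perm (Fin n) => fz4 π) fun π => (inv π : ℤ) := by
  refine .trans (.symm (linHist_equidist_cycHist
    (fun l => (2 * ldif l - ldes l - lsum l : ℤ)) (fun π => ?_) fun π => ?_)) madl_equidist_inv
  · have := pat2_31_add_pat31_2_add_des π
    rw [ldif_linHist, ldes_linHist, lsum_linHist, madl]
    omega
  · rw [ldif_cycHist, ldes_cycHist, lsum_cycHist, fz4]

end Unshifted

/-! ### Shifted cyclic statistics -/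

section Kappa

variable {n : ℕ}

/-- Spreads a correction at `pone π` over all positions, so that the identities below can be checked
position by position. -/
lemma sum_ite_word_eq_one_and (π : Equiv.Perm (Fin n)) (hn : 1 ≤ n) (f : ℕ → ℤ) :
    (∑ j ∈ Icc 1 n, if word π j = 1 then f j else 0) = f (pone π) := by
  have h1 : (1 : ℕ) ∈ Icc 1 n := by simp [hn]
  rw [sum_eq_single_of_mem (pone π) (word_mem π⁻¹ h1)]
  · rw [if_pos]
    exact word_word_inv π le_rfl hn
  · intro j hj hne
    exact if_neg fun h => hne ((word_inv_eq_iff hj h1).2 h).symm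

/-- The word of the inverse of the rotated inverse of `π`. -/
def rotLetter (π : Equiv.Perm (Fin n)) (i : ℕ) : ℕ := if word π i = 1 then n else word π i - 1

/-- The permutation `π⁻¹(2) ⋯ π⁻¹(n) π⁻¹(1)`. -/
lemma exists_rotated_inverse (π : Equiv.Perm (Fin n)) : ∃ κ : Equiv.Perm (Fin n), ∀ i ∈ Icc 1 n,
    word κ i = (if i = n then word π⁻¹ 1 else word π⁻¹ (i + 1)) ∧
      word κ⁻¹ i = rotLetter π i := by
  refine exists_perm_word (fun i => if i = n then word π⁻¹ 1 else word π⁻¹ (i + 1)) (rotLetter π)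
    ?_ ?_ ?_ ?_ <;> intro i hi <;> rw [mem_Icc] at hi
  · split_ifs with h
    · exact word_mem _ (by rw [mem_Icc]; omega)
    · exact word_mem _ (by rw [mem_Icc]; omega)
  · have h1 := one_le_word π hi.1 hi.2
    have h2 := word_le π hi.1 hi.2
    rw [mem_Icc, rotLetter]
    split_ifs <;> omega
  · by_cases h : i = n
    · rw [if_pos h, rotLetter, word_word_inv π le_rfl (by omega), if_pos rfl, h]
    · rw [if_neg h, rotLetter, word_word_inv π (by omega) (by omega), if_neg (by omega),
        Nat.add_sub_cancel]
  · have h1 := one_le_word π hi.1 hi.2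
    have h2 := word_le π hi.1 hi.2
    have h3 := word_inv_word π hi.1 hi.2
    by_cases h : word π i = 1
    · have hr : rotLetter π i = n := if_pos h
      rw [if_pos hr, ← h, h3]
    · have hr : rotLetter π i = word π i - 1 := if_neg h
      rw [hr, if_neg (by omega), Nat.sub_add_cancel h1, h3]

/-- The permutation `π⁻¹(2) ⋯ π⁻¹(n) π⁻¹(1)`. -/
noncomputable def rotInv (π : Equiv.Perm (Fin n)) : Equiv.Perm (Fin n) :=
  (exists_rotated_inverse π).choose

variable (π : Equiv.Perm (Fin n))

lemma word_rotInv {i : ℕ} (hi : i ∈ Icc 1 n) :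
    word (rotInv π) i = if i = n then word π⁻¹ 1 else word π⁻¹ (i + 1) :=
  ((exists_rotated_inverse π).choose_spec i hi).1

lemma word_rotInv_inv {i : ℕ} (hi : i ∈ Icc 1 n) : word (rotInv π)⁻¹ i = rotLetter π i :=
  ((exists_rotated_inverse π).choose_spec i hi).2

lemma word_rotInv_rotLetter {i : ℕ} (hi : i ∈ Icc 1 n) : word (rotInv π) (rotLetter π i) = i := by
  rw [← word_rotInv_inv π hi, word_word_inv _ (mem_Icc.1 hi).1 (mem_Icc.1 hi).2]

lemma rotInv_injective : Function.Injective (rotInv (n := n)) := by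
  intro π σ h
  refine word_ext fun i hi => ?_
  have h1 : rotLetter π i = rotLetter σ i := by
    rw [← word_rotInv_inv π hi, ← word_rotInv_inv σ hi, h]
  have h2 := word_mem π hi
  have h3 := word_mem σ hi
  rw [mem_Icc] at h2 h3
  rw [rotLetter, rotLetter] at h1
  split_ifs at h1 <;> omega

/-! ### Cyclic statistics of the rotated inverse -/

lemma last_rotInv (hn : 1 ≤ n) : last (rotInv π) = pone π := by
  rw [last, word_rotInv π (by simp [hn]), if_pos rfl, pone]

/-- A sum over the positions of the rotated inverse as a sum over the positions of `π`. -/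
lemma sum_rotInv {M : Type*} [AddCommMonoid M] (f : ℕ → ℕ → M) :
    ∑ v ∈ Icc 1 n, f v (word (rotInv π) v) = ∑ i ∈ Icc 1 n, f (rotLetter π i) i := by
  rw [← sum_word (rotInv π)⁻¹]
  refine sum_congr rfl fun i hi => ?_
  rw [word_rotInv_inv π hi, word_rotInv_rotLetter π hi]

lemma exc_rotInv (hn : 1 ≤ n) : (exc (rotInv π) : ℤ) = n - 1 - exc π := by
  have h1 := sum_ite_word_eq_one_and π hn fun _ => 1
  have h2 : (exc (rotInv π) : ℤ) + exc π
      + ∑ i ∈ Icc 1 n, (if word π i = 1 then (1 : ℤ) else 0) = ∑ i ∈ Icc 1 n, 1 := by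
    rw [exc_eq_card, exc_eq_card, Ep, Ep, card_filter, card_filter,
      sum_rotInv π (fun v w => if w > v then 1 else 0)]
    push_cast
    rw [← sum_add_distrib, ← sum_add_distrib]
    refine sum_congr rfl fun i hi => ?_
    have h3 := word_mem π hi
    rw [mem_Icc] at h3 hi
    rw [rotLetter]
    split_ifs <;> omega
  rw [h1] at h2
  simp at h2
  omega

/-- The excedance positions of the rotated inverse are the `π(i) - 1` with `π(i) ≤ i` and `π(i) ≠
1`; the letter 1 would contribute 0 anyway. -/
lemma ebot_rotInv : ebot (rotInv π) = vbot π := by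
  have h0 : vbot π = ∑ v ∈ Icc 1 n, if v ∈ Exc π then 0 else v - 1 := by
    rw [vbot, Vbot, Multiset.card_sum, Vnex, sum_filter]
    simp only [Multiset.card_replicate]
    have h1 := sum_Ico_add' (fun v => if v ∈ Exc π then 0 else v - 1) 1 n 1
    simp only [Nat.add_sub_cancel] at h1
    simp only [ite_not, h1]
    refine sum_subset_zero_on_sdiff (fun v => ?_) (fun v hv => ?_) fun v _ => ?_
    · simp only [mem_Ico, mem_Icc]; omega
    · simp only [mem_Ico, mem_Icc, mem_sdiff] at hv
      have : v - 1 = 0 := by omega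
      simp [this]
    · rfl
  rw [h0, ebot_eq_sum, Ep, sum_filter, sum_rotInv π (fun v w => if w > v then v else 0),
    ← sum_word π fun v => if v ∈ Exc π then 0 else v - 1]
  refine sum_congr rfl fun i hi => ?_
  have h1 : word π i ∈ Exc π ↔ i < word π i := by
    rw [Exc, word_mem_image_iff (show Ep π ⊆ Icc 1 n from filter_subset _ _) (word_mem π hi),
        mem_Ep,
      word_inv_word π (mem_Icc.1 hi).1 (mem_Icc.1 hi).2]
    exact and_iff_right hi
  have h3 := word_mem π hi
  rw [mem_Icc] at h3 hi
  simp only [h1, rotLetter]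
  split_ifs <;> omega

/-- The two sides sum the positive and the negative parts of `i - rotLetter π i`, and these
differences cancel in total since `rotLetter π` permutes the positions. -/
lemma edif_rotInv (hn : 1 ≤ n) : edif (rotInv π) = vedif π := by
  have h1 := sum_ite_word_eq_one_and π hn fun i => (n : ℤ) - i
  have hp := word_le π⁻¹ (i := 1) le_rfl hn
  rw [← pone] at hp
  have h2 : (vedif π : ℤ) = (∑ i ∈ Icc 1 n, if i < word π i then
      ((word π i - i - 1 : ℕ) : ℤ) else 0)
      + (n - pone π) := by
    rw [vedif, Vedif, Multiset.card_add, Multiset.card_sum, Ep, sum_filter]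
    simp only [Finset.card_val, Nat.card_Ioo, Nat.card_Ioc]
    push_cast [hp]
    rfl
  have h3 : (edif (rotInv π) : ℤ)
      = ∑ i ∈ Icc 1 n, if rotLetter π i < i then ((i - rotLetter π i : ℕ) : ℤ) else 0 := by
    rw [edif_eq_sum, Ep, sum_filter, sum_rotInv π (fun v w => if w > v then w - v else 0)]
    push_cast
    rfl
  have h4 : ∑ i ∈ Icc 1 n, (rotLetter π i : ℤ) = ∑ i ∈ Icc 1 n, (i : ℤ) := by
    rw [← sum_rotInv π fun v _ => (v : ℤ)]
  have h5 : (edif (rotInv π) : ℤ) + ∑ i ∈ Icc 1 n, (rotLetter π i : ℤ)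
      = vedif π + ∑ i ∈ Icc 1 n, (i : ℤ) := by
    rw [h2, h3, ← h1, ← sum_add_distrib, ← sum_add_distrib, ← sum_add_distrib]
    refine sum_congr rfl fun i hi => ?_
    have h3 := word_mem π hi
    rw [mem_Icc] at h3 hi
    simp only [rotLetter]
    split_ifs <;> omega
  omega

/-- Lowering all letters by one preserves comparisons except with the letter 1, which turns from
least into greatest. The adjustments in `vnestAt` record the effect of this one letter. -/
lemma side_rotInv (hn : 1 ≤ n) {i : ℕ} (hi : i ∈ Icc 1 n) :
    side (rotInv π) (rotLetter π i) = vnestAt π i := by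
  have hρ : rotLetter π i ∈ Icc 1 n := by
    rw [← word_rotInv_inv π hi]; exact word_mem _ hi
  have hw := word_mem π hi
  have hpo := word_word_inv π (i := 1) le_rfl hn
  rw [← pone] at hpo
  rw [side_eq_sum _ _ hρ, word_rotInv_rotLetter π hi,
    sum_rotInv π (fun v w => (if rotLetter π i < i ∧ v < w ∧ v < rotLetter π i ∧ i < w then 1 else
        0)
      + if i ≤ rotLetter π i ∧ w ≤ v ∧ rotLetter π i < v ∧ w < i then 1 else 0)]
  have hnest : nest π i = ∑ j ∈ Icc 1 n, if (j < i ∧ i < word π i ∧ word π i < word π j) ∨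
    (word π j < word π i ∧ word π i ≤ i ∧ i < j) then 1 else 0 := by rw [nest, card_filter]
  rw [mem_Icc] at hi hw
  by_cases h1 : word π i = 1
  · have h2 : pone π = i := by rw [pone, ← h1, word_inv_word π hi.1 hi.2]
    rw [vnestAt, if_neg (by omega), if_neg (by omega), hnest]
    refine sum_congr rfl fun j hj => ?_
    have h3 := word_mem π hj
    rw [mem_Icc] at h3 hj
    simp only [rotLetter, h1, if_true]
    split_ifs <;> omega
  have hne : pone π ≠ i := fun h => h1 (h ▸ hpo)
  by_cases h2 : i < word π i
  · have h4 := sum_ite_word_eq_one_and π hn fun j => if j < i then 1 else 0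
    have h5 : (vnestAt π i : ℤ) = nest π i + if pone π < i then 1 else 0 := by
      rw [vnestAt, if_neg (by omega)]
      split_ifs <;> omega
    zify
    rw [h5, ← h4, hnest]
    push_cast
    rw [← sum_add_distrib]
    refine sum_congr rfl fun j hj => ?_
    have h3 := word_mem π hj
    rw [mem_Icc] at h3 hj
    simp only [rotLetter, h1, if_false]
    split_ifs <;> omega
  · have h4 := sum_ite_word_eq_one_and π hn fun j => if i < j then 1 else 0
    -- Moving the correction to the other side shows that the subtraction in `vnestAt` is exact.
    have h6 : ∀ x : ℕ, (x : ℤ) + (if i < pone π then 1 else 0) = nest π i → x = vnestAt π i := by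
      intro x hx
      rw [vnestAt]
      split_ifs at hx ⊢ <;> omega
    refine h6 _ ?_
    rw [← h4, hnest]
    push_cast
    rw [← sum_add_distrib]
    refine sum_congr rfl fun j hj => ?_
    have h3 := word_mem π hj
    rw [mem_Icc] at h3 hj
    simp only [rotLetter, h1, if_false]
    split_ifs <;> omega

lemma ine_rotInv (hn : 1 ≤ n) : ine (rotInv π) = vnest π := by
  rw [ine_eq_sum, sum_rotInv π (fun v _ => side (rotInv π) v), vnest, Vnest, Multiset.card_sum]
  simp only [Multiset.card_replicate]
  exact sum_congr rfl fun i hi => side_rotInv π hn hi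

end Kappa

/-! ### Permutations that end with their least letter -/

section Shift

variable {n : ℕ}

lemma exists_linShift (π : Equiv.Perm (Fin n)) : ∃ σ : Equiv.Perm (Fin (n + 1)),
    ∀ i ∈ Icc 1 (n + 1), word σ i = (if i = n + 1 then 1 else word π i + 1) ∧
      word σ⁻¹ i = if i = 1 then n + 1 else word π⁻¹ (i - 1) := by
  refine exists_perm_word (fun i => if i = n + 1 then 1 else word π i + 1)
    (fun i => if i = 1 then n + 1 else word π⁻¹ (i - 1)) ?_ ?_ ?_ ?_ <;>
    intro i hi <;> rw [mem_Icc] at hi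
  · split_ifs with h
    · simp
    · have := word_le π (i := i) hi.1 (by omega)
      rw [mem_Icc]; omega
  · split_ifs with h
    · simp
    · have := word_mem π⁻¹ (i := i - 1) (by rw [mem_Icc]; omega)
      rw [mem_Icc] at this ⊢; omega
  · by_cases h : i = n + 1
    · rw [if_pos h, if_pos rfl, h]
    · have := one_le_word π (i := i) hi.1 (by omega)
      rw [if_neg h, if_neg (by omega), Nat.add_sub_cancel, word_inv_word π hi.1 (by omega)]
  · by_cases h : i = 1
    · rw [if_pos h, if_pos rfl, h]
    · have := word_le π⁻¹ (i := i - 1) (by omega) (by omega)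
      rw [if_neg h, if_neg (by omega), word_word_inv π (by omega) (by omega)]
      omega

/-- The permutation `(π(1) + 1) ⋯ (π(n) + 1) 1`. -/
noncomputable def linShift (π : Equiv.Perm (Fin n)) : Equiv.Perm (Fin (n + 1)) :=
  (exists_linShift π).choose

lemma word_linShift (π : Equiv.Perm (Fin n)) {i : ℕ} (h1 : 1 ≤ i) (h2 : i ≤ n) :
    word (linShift π) i = word π i + 1 := by
  have h : word (linShift π) i = _ :=
    ((exists_linShift π).choose_spec i (by rw [mem_Icc]; omega)).1
  rw [h, if_neg (by omega)]

lemma word_linShift_last (π : Equiv.Perm (Fin n)) : word (linShift π) (n + 1) = 1 := by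
  have h : word (linShift π) (n + 1) = _ := ((exists_linShift π).choose_spec (n + 1) (by simp)).1
  rw [h, if_pos rfl]

lemma linShift_injective : Function.Injective (linShift (n := n)) := by
  intro π σ h
  refine word_ext fun i hi => ?_
  rw [mem_Icc] at hi
  have h1 := word_linShift π hi.1 hi.2
  rw [h, word_linShift σ hi.1 hi.2] at h1
  omega

lemma exists_linShift_eq {σ : Equiv.Perm (Fin (n + 1))} (hσ : word σ (n + 1) = 1) :
    ∃ π, linShift π = σ := by
  have hinv : word σ⁻¹ 1 = n + 1 := (word_inv_eq_iff (by simp) (by simp)).2 hσ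
  have h1 : ∀ i, 1 ≤ i → i ≤ n → 2 ≤ word σ i ∧ word σ i ≤ n + 1 := by
    intro i hi hin
    have h2 := word_mem σ (i := i) (by rw [mem_Icc]; omega)
    have h3 : word σ i ≠ 1 := fun h3 => by
      have := word_inj σ (i := i) (j := n + 1) (by rw [mem_Icc]; omega) (by simp) (h3.trans hσ.symm)
      omega
    rw [mem_Icc] at h2
    omega
  have h4 : ∀ i, 1 ≤ i → i ≤ n → 1 ≤ word σ⁻¹ (i + 1) ∧ word σ⁻¹ (i + 1) ≤ n := by
    intro i hi hin
    have h2 := word_mem σ⁻¹ (i := i + 1) (by rw [mem_Icc]; omega)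
    have h3 : word σ⁻¹ (i + 1) ≠ n + 1 := fun h3 => by
      have := word_inj σ⁻¹ (i := i + 1) (j := 1) (by rw [mem_Icc]; omega) (by simp)
        (h3.trans hinv.symm)
      omega
    rw [mem_Icc] at h2
    omega
  obtain ⟨π, hπ⟩ := exists_perm_word (n := n) (fun i => word σ i - 1) (fun i => word σ⁻¹ (i + 1))
    (fun i hi => by
      rw [mem_Icc] at hi ⊢
      have := h1 i hi.1 hi.2
      omega)
    (fun i hi => by
      rw [mem_Icc] at hi ⊢
      exact h4 i hi.1 hi.2)
    (fun i hi => by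
      rw [mem_Icc] at hi
      have := h1 i hi.1 hi.2
      rw [Nat.sub_add_cancel (by omega), word_inv_word σ hi.1 (by omega)])
    (fun i hi => by
      rw [mem_Icc] at hi
      rw [word_word_inv σ (by omega) (by omega), Nat.add_sub_cancel])
  refine ⟨π, word_ext fun i hi => ?_⟩
  rw [mem_Icc] at hi
  rcases Nat.lt_or_ge n i with h | h
  · obtain rfl : i = n + 1 := by omega
    rw [word_linShift_last, hσ]
  · have := h1 i hi.1 h
    rw [word_linShift π hi.1 h, (hπ i (by rw [mem_Icc]; omega)).1]
    omega

variable (π : Equiv.Perm (Fin n))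

/-! ### Linear statistics after a least letter is appended -/

lemma one_le_last (hn : 1 ≤ n) : 1 ≤ last π := one_le_word π hn le_rfl

lemma sum_Des_linShift (hn : 1 ≤ n) (f : ℕ → ℕ → ℕ) :
    ∑ j ∈ Des (linShift π), f (word (linShift π) j) (word (linShift π) (j + 1))
      = ∑ j ∈ Des π, f (word π j + 1) (word π (j + 1) + 1) + f (last π + 1) 1 := by
  rw [Des, Des, sum_filter, sum_filter, sum_Ico_succ_top hn, word_linShift_last,
    word_linShift π hn le_rfl, if_pos (by have := one_le_word π hn le_rfl; omega), last]
  congr 1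
  refine sum_congr rfl fun j hj => ?_
  rw [mem_Ico] at hj
  rw [word_linShift π hj.1 (by omega), word_linShift π (by omega) (by omega)]
  split_ifs <;> first | rfl | omega

lemma des_linShift (hn : 1 ≤ n) : des (linShift π) = des π + 1 := by
  rw [des, des, card_eq_sum_ones, card_eq_sum_ones]
  exact sum_Des_linShift π hn fun _ _ => 1

lemma dbot_linShift (hn : 1 ≤ n) : dbot (linShift π) = dbot π + des π + 1 := by
  rw [dbot_eq_sum, dbot_eq_sum, sum_Des_linShift π hn fun _ b => b, sum_add_distrib, des,
    card_eq_sum_ones]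

lemma ddif_linShift (hn : 1 ≤ n) : ddif (linShift π) = ddif π + last π := by
  rw [ddif_eq_sum, ddif_eq_sum, sum_Des_linShift π hn fun a b => a - b]
  simp

lemma card_letters_lt {v : ℕ} (hv : v ∈ Icc 1 n) :
    (∑ i ∈ Icc 1 n, if word π i < v then 1 else 0) = v - 1 := by
  rw [sum_word π fun w => if w < v then 1 else 0, ← card_filter]
  have : ({w ∈ Icc 1 n | w < v} : Finset ℕ) = Ico 1 v := by
    ext w
    rw [mem_Icc] at hv
    simp only [mem_filter, mem_Icc, mem_Ico]
    omega
  rw [this, Nat.card_Ico]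

/-- The new final descent embraces the images of the `π(n) - 1` letters below `π(n)`, all of which
stand to its left. -/
lemma pat2_31_linShift (hn : 1 ≤ n) : pat2_31 (linShift π) + 1 = pat2_31 π + last π := by
  have h1 : pat2_31 (linShift π) = ∑ j ∈ Ico 1 (n + 1), ∑ i ∈ Icc 1 n,
      if i < j ∧ word (linShift π) (j + 1) < word π i + 1 ∧
        word π i + 1 < word (linShift π) j then 1 else 0 := by
    rw [pat2_31, card_filter, sum_product, sum_comm]
    refine sum_congr rfl fun j hj => ?_
    rw [mem_Ico] at hj
    rw [sum_Icc_succ, if_neg (by omega), Nat.add_zero]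
    refine sum_congr rfl fun i hi => ?_
    rw [mem_Icc] at hi
    rw [word_linShift π hi.1 hi.2]
  have h2 : pat2_31 π = ∑ j ∈ Ico 1 n, ∑ i ∈ Icc 1 n,
      if i < j ∧ word π (j + 1) < word π i ∧ word π i < word π j then 1 else 0 := by
    rw [pat2_31, card_filter, sum_product, sum_comm]
  have h3 := card_letters_lt π (v := last π) (word_mem π (by simp [hn]))
  have h4 := one_le_last π hn
  rw [h1, h2, sum_Ico_succ_top hn, word_linShift_last, word_linShift π hn le_rfl]
  have h5 : (∑ i ∈ Icc 1 n, if i < n ∧ 1 < word π i + 1 ∧ word π i + 1 < word π n + 1 then 1 else 0)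
      = last π - 1 := by
    rw [← h3]
    refine sum_congr rfl fun i hi => ?_
    have h6 := word_mem π hi
    rw [mem_Icc] at h6 hi
    have h7 : i = n → word π i = word π n := fun h => by rw [h]
    rw [last]
    split_ifs <;> omega
  have h6 : (∑ j ∈ Ico 1 n, ∑ i ∈ Icc 1 n,
      if i < j ∧ word (linShift π) (j + 1) < word π i + 1 ∧
        word π i + 1 < word (linShift π) j then 1 else 0) = ∑ j ∈ Ico 1 n, ∑ i ∈ Icc 1 n,
      if i < j ∧ word π (j + 1) < word π i ∧ word π i < word π j then 1 else 0 := by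
    refine sum_congr rfl fun j hj => sum_congr rfl fun i _ => ?_
    rw [mem_Ico] at hj
    rw [word_linShift π hj.1 (by omega), word_linShift π (by omega) (by omega)]
    split_ifs <;> omega
  rw [h5, h6]
  omega

lemma inv_eq_sum : inv π =
    ∑ i ∈ Icc 1 n, ∑ j ∈ Icc 1 n, if i < j ∧ word π i > word π j then 1 else 0 := by
  rw [inv, card_filter, sum_product]

lemma inv_linShift : inv (linShift π) = inv π + n := by
  rw [inv_eq_sum, inv_eq_sum, sum_Icc_succ]
  have h1 : (∑ j ∈ Icc 1 (n + 1),
      if n + 1 < j ∧ word (linShift π) (n + 1) > word (linShift π) j then 1 else 0) = 0 :=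
    sum_eq_zero fun j hj => if_neg fun h => by rw [mem_Icc] at hj; omega
  rw [h1, Nat.add_zero]
  trans ∑ i ∈ Icc 1 n, ((∑ j ∈ Icc 1 n, if i < j ∧ word π i > word π j then 1 else 0) + 1)
  swap
  · rw [sum_add_distrib]
    simp
  refine sum_congr rfl fun i hi => ?_
  have h3 := word_mem π hi
  rw [mem_Icc] at h3 hi
  rw [sum_Icc_succ, word_linShift_last, word_linShift π hi.1 hi.2, if_pos (by omega)]
  congr 1
  refine sum_congr rfl fun j hj => ?_
  rw [mem_Icc] at hj
  rw [word_linShift π hj.1 hj.2]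
  split_ifs <;> omega

/-! ### Rotation of the positions -/

lemma word_mul (π σ : Equiv.Perm (Fin n)) {i : ℕ} (h1 : 1 ≤ i) (h2 : i ≤ n) :
    word (π * σ) i = word π (word σ i) := by
  rw [word_eq _ h1 h2, word_eq π (one_le_word σ h1 h2) (word_le σ h1 h2)]
  simp [word_eq σ h1 h2]

lemma exists_rotation (n : ℕ) : ∃ c : Equiv.Perm (Fin n), ∀ i ∈ Icc 1 n,
    word c i = (if i = n then 1 else i + 1) ∧ word c⁻¹ i = if i = 1 then n else i - 1 := by
  refine exists_perm_word (fun i => if i = n then 1 else i + 1)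
    (fun i => if i = 1 then n else i - 1) ?_ ?_ ?_ ?_ <;> intro i hi <;> rw [mem_Icc] at hi
  · rw [mem_Icc]; split_ifs <;> omega
  · rw [mem_Icc]; split_ifs <;> omega
  · split_ifs <;> omega
  · split_ifs <;> omega

/-- The permutation `2 3 ⋯ n 1`. -/
noncomputable def rotation (n : ℕ) : Equiv.Perm (Fin n) := (exists_rotation n).choose

lemma word_rotation {i : ℕ} (hi : i ∈ Icc 1 n) :
    word (rotation n) i = if i = n then 1 else i + 1 :=
  ((exists_rotation n).choose_spec i hi).1

lemma word_rotation_inv {i : ℕ} (hi : i ∈ Icc 1 n) :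
    word (rotation n)⁻¹ i = if i = 1 then n else i - 1 :=
  ((exists_rotation n).choose_spec i hi).2

/-- The permutation `π(n) π(1) ⋯ π(n-1)`. -/
noncomputable def rot (π : Equiv.Perm (Fin n)) : Equiv.Perm (Fin n) := π * (rotation n)⁻¹

lemma rot_injective : Function.Injective (rot (n := n)) := fun _ _ h => mul_right_cancel h

lemma exists_rot_eq (σ : Equiv.Perm (Fin n)) : ∃ π, rot π = σ :=
  ⟨σ * rotation n, by rw [rot, mul_inv_cancel_right]⟩

lemma word_rot {i : ℕ} (hi : i ∈ Icc 1 n) :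
    word (rot π) i = word π (if i = 1 then n else i - 1) := by
  rw [rot, word_mul π _ (mem_Icc.1 hi).1 (mem_Icc.1 hi).2, word_rotation_inv hi]

lemma word_rot_rotation {i : ℕ} (hi : i ∈ Icc 1 n) :
    word (rot π) (word (rotation n) i) = word π i := by
  rw [← word_mul _ _ (mem_Icc.1 hi).1 (mem_Icc.1 hi).2, rot, inv_mul_cancel_right]

/-- Moving `π(n)` to the front destroys its `n - π(n)` inversions and creates `π(n) - 1` new ones.
-/
lemma inv_rot (hn : 1 ≤ n) : inv (rot π) + n + 1 = inv π + 2 * last π := by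
  have hm : n ∈ Icc 1 n := by simp [hn]
  have hl := word_mem π hm
  rw [mem_Icc] at hl
  have h1 := card_letters_lt π (v := word π n) (word_mem π hm)
  have h2 : (∑ i ∈ Icc 1 n, if word π n < word π i then 1 else 0) = n - word π n := by
    rw [sum_word π fun w => if word π n < w then 1 else 0, ← card_filter]
    have : ({w ∈ Icc 1 n | word π n < w} : Finset ℕ) = Ioc (word π n) n := by
      ext w
      simp only [mem_filter, mem_Icc, mem_Ioc]
      omega
    rw [this, Nat.card_Ioc]
  have h3 : (∑ i ∈ Icc 1 n, ∑ j ∈ Icc 1 n, if j = n ∧ word π n < word π i then 1 else 0)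
      = n - word π n := by
    rw [← h2]
    refine sum_congr rfl fun i _ => ?_
    rw [sum_ite_eq_and n hm fun _ => word π n < word π i]
    by_cases h : word π n < word π i <;> simp [h]
  have h4 : (∑ i ∈ Icc 1 n, ∑ j ∈ Icc 1 n, if i = n ∧ word π j < word π n then 1 else 0)
      = word π n - 1 := by
    rw [← h1, sum_comm]
    refine sum_congr rfl fun i _ => ?_
    rw [sum_ite_eq_and n hm fun _ => word π i < word π n]
    by_cases h : word π i < word π n <;> simp [h]
  have h5 : inv (rot π) = ∑ i ∈ Icc 1 n, ∑ j ∈ Icc 1 n,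
      if word (rotation n) i < word (rotation n) j ∧ word π i > word π j then 1 else 0 := by
    rw [inv_eq_sum, ← sum_word (rotation n)]
    refine sum_congr rfl fun i hi => ?_
    rw [← sum_word (rotation n)]
    refine sum_congr rfl fun j hj => ?_
    rw [word_rot_rotation π hi, word_rot_rotation π hj]
  have h6 : inv (rot π) + (n - word π n) = inv π + (word π n - 1) := by
    rw [h5, inv_eq_sum, ← h3, ← h4, ← sum_add_distrib, ← sum_add_distrib]
    refine sum_congr rfl fun i hi => ?_
    rw [← sum_add_distrib, ← sum_add_distrib]
    refine sum_congr rfl fun j hj => ?_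
    rw [word_rotation hi, word_rotation hj]
    rw [mem_Icc] at hi hj
    have h7 : i = n → word π i = word π n := fun h => by rw [h]
    have h8 : j = n → word π j = word π n := fun h => by rw [h]
    split_ifs <;> omega
  rw [last]
  omega

/-- The permutation `(π(n) + 1) (π(1) + 1) ⋯ (π(n-1) + 1) 1`. -/
noncomputable def cycShift (π : Equiv.Perm (Fin n)) : Equiv.Perm (Fin (n + 1)) := linShift (rot π)

lemma exists_cycShift_eq {σ : Equiv.Perm (Fin (n + 1))} (hσ : word σ (n + 1) = 1) :
    ∃ π, cycShift π = σ := by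
  obtain ⟨τ, rfl⟩ := exists_linShift_eq hσ
  obtain ⟨π, rfl⟩ := exists_rot_eq τ
  exact ⟨π, rfl⟩

lemma word_cycShift_one (hn : 1 ≤ n) : word (cycShift π) 1 = last π + 1 := by
  rw [cycShift, word_linShift _ le_rfl hn, word_rot π (by simp [hn]), if_pos rfl, last]

lemma word_cycShift_succ {i : ℕ} (h1 : 1 ≤ i) (h2 : i < n) :
    word (cycShift π) (i + 1) = word π i + 1 := by
  rw [cycShift, word_linShift _ (i := i + 1) (by omega) h2, word_rot π (by simp; omega), if_neg (by
      omega),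
    Nat.add_sub_cancel]

/-- Positions and letters of excedances both go up by one. The rotation is there for this; the old
last letter becomes a new excedance in front. -/
lemma Ep_cycShift (hn : 1 ≤ n) : Ep (cycShift π) = insert 1 ((Ep π).image (· + 1)) := by
  ext i
  have hlast : word (cycShift π) (n + 1) = 1 := word_linShift_last _
  rw [mem_insert, mem_image, mem_Ep, mem_Icc]
  constructor
  · rintro ⟨hi, h⟩
    by_cases h1 : i = 1
    · exact Or.inl h1
    · obtain ⟨j, rfl⟩ : ∃ j, i = j + 1 := ⟨i - 1, by omega⟩
      have h2 : j ≠ n := by rintro rfl; omega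
      rw [word_cycShift_succ π (by omega) (by omega)] at h
      exact Or.inr ⟨j, (mem_Ep π).2 ⟨by rw [mem_Icc]; omega, by omega⟩, rfl⟩
  · rintro (rfl | ⟨j, hj, rfl⟩)
    · have := one_le_last π hn
      rw [word_cycShift_one π hn]
      omega
    · obtain ⟨hj, h⟩ := (mem_Ep π).1 hj
      have h2 := word_mem π hj
      rw [mem_Icc] at hj h2
      rw [word_cycShift_succ π hj.1 (by omega)]
      omega

lemma sum_Ep_cycShift (hn : 1 ≤ n) (f : ℕ → ℕ → ℕ) :
    ∑ i ∈ Ep (cycShift π), f i (word (cycShift π) i)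
      = ∑ i ∈ Ep π, f (i + 1) (word π i + 1) + f 1 (last π + 1) := by
  rw [Ep_cycShift π hn, sum_insert, word_cycShift_one π hn, Nat.add_comm, sum_image (by simp)]
  · congr 1
    refine sum_congr rfl fun i hi => ?_
    obtain ⟨hi, h⟩ := (mem_Ep π).1 hi
    have h2 := word_mem π hi
    rw [mem_Icc] at hi h2
    rw [word_cycShift_succ π hi.1 (by omega)]
  · intro h
    obtain ⟨j, hj, h1⟩ := mem_image.1 h
    have := mem_Icc.1 ((mem_Ep π).1 hj).1
    omega

lemma exc_cycShift (hn : 1 ≤ n) : exc (cycShift π) = exc π + 1 := by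
  rw [exc_eq_card, exc_eq_card, card_eq_sum_ones, card_eq_sum_ones]
  exact sum_Ep_cycShift π hn fun _ _ => 1

lemma ebot_cycShift (hn : 1 ≤ n) : ebot (cycShift π) = ebot π + exc π + 1 := by
  rw [ebot_eq_sum, ebot_eq_sum, sum_Ep_cycShift π hn fun i _ => i, sum_add_distrib, exc_eq_card,
    card_eq_sum_ones]

lemma edif_cycShift (hn : 1 ≤ n) : edif (cycShift π) = edif π + last π := by
  rw [edif_eq_sum, edif_eq_sum, sum_Ep_cycShift π hn fun i w => w - i]
  simp

/-- Obtained from the effect on `inv` and `edif`, without looking at side numbers. -/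
lemma ine_cycShift (hn : 1 ≤ n) : ine (cycShift π) + 1 = ine π + last π := by
  have h1 := inv_eq_edif_add_ine π
  have h2 := inv_eq_edif_add_ine (cycShift π)
  have h3 := inv_rot π hn
  have h4 : inv (cycShift π) = inv (rot π) + n := inv_linShift _
  have h5 := edif_cycShift π hn
  omega

end Shift

/-! ### Histories of permutations that end with their least letter -/

/-- All weights that do not belong to a top are positive, except at the first step. -/
def Shifted : List Step → Prop
  | [] => True
  | (_, t, s) :: l => Shifted l ∧ (t = false → l ≠ [] → 1 ≤ s)

lemma shifted_hist {b t : ℕ → Bool} {s : ℕ → ℕ} {n : ℕ} :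
    Shifted (hist b t s n) ↔ ∀ i, 2 ≤ i → i ≤ n → t i = false → 1 ≤ s i := by
  induction n with
  | zero => exact ⟨fun _ i h1 h2 => by omega, fun _ => trivial⟩
  | succ n ih =>
    have h0 : hist b t s n ≠ [] ↔ 1 ≤ n := by
      rw [← List.length_pos_iff, length_hist, Nat.succ_le_iff]
    simp only [hist, Shifted, ih, h0]
    constructor
    · rintro ⟨h1, h2⟩ i hi hin hti
      rcases Nat.lt_or_ge i (n + 1) with h | h
      · exact h1 i hi (by omega) hti
      · obtain rfl : i = n + 1 := by omega
        exact h2 hti (by omega)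
    · intro h
      exact ⟨fun i hi hin => h i hi (by omega), fun h1 h2 => h _ (by omega) le_rfl h1⟩

section ShiftedHist

variable {m : ℕ} {σ : Equiv.Perm (Fin m)}

/-- A last letter other than 1 is not a top and has weight 0. Conversely, if the word ends with 1,
then after any larger letter that is not a top the word first climbs and later drops below it. -/
lemma shifted_linHist_iff (hm : 1 ≤ m) : Shifted (linHist σ) ↔ word σ m = 1 := by
  rw [linHist, shifted_hist]
  constructor
  · intro h
    by_contra hne
    have h1 := one_le_word σ hm le_rfl
    have h2 := word_inv_word σ hm le_rfl
    have h3 := h (word σ m) (by omega) (word_le σ hm le_rfl)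
      (decide_eq_false fun ht => by have := ht.1; omega)
    rw [rightEmbrace, h2, Nat.succ_le_iff, card_pos] at h3
    obtain ⟨j, hj⟩ := h3
    rw [mem_filter, mem_Ico] at hj
    omega
  · intro h v hv hvm ht
    have ht : ¬ IsTop σ v := of_decide_eq_false ht
    have hp := word_mem σ⁻¹ (i := v) (by rw [mem_Icc]; omega)
    have hw := word_word_inv σ (i := v) (by omega) hvm
    rw [mem_Icc] at hp
    have hpm : word σ⁻¹ v ≠ m := fun he => by rw [he] at hw; omega
    -- The descent into the first smaller letter to the right of `v` embraces `v`.
    have hex : ∃ q, word σ⁻¹ v < q ∧ word σ q < v := ⟨m, by omega, by omega⟩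
    classical
    have hq := Nat.find_spec hex
    have hmin := fun k => Nat.find_min hex (m := k)
    have hle : Nat.find hex ≤ m := Nat.find_min' hex ⟨by omega, by omega⟩
    set q := Nat.find hex
    have hne : q ≠ word σ⁻¹ v + 1 := fun he => ht ⟨by omega, by rw [← he]; exact hq.2⟩
    have h2 := hmin (q - 1) (by omega)
    have h3 : word σ (q - 1) ≠ v := fun he => by
      have := word_inv_word σ (i := q - 1) (by omega) (by omega)
      rw [he] at this
      omega
    rw [rightEmbrace, Nat.succ_le_iff, card_pos]
    refine ⟨q - 1, ?_⟩
    rw [mem_filter, mem_Ico, Nat.sub_add_cancel (by omega)]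
    omega

/-- The letter at the last position is a non-excedance with side number 0. If it is 1, it counts in
the side number of every other non-excedance. -/
lemma shifted_cycHist_iff (hm : 1 ≤ m) : Shifted (cycHist σ) ↔ word σ m = 1 := by
  have hle := word_le σ hm le_rfl
  rw [cycHist, shifted_hist]
  constructor
  · intro h
    by_contra hne
    have h1 := one_le_word σ hm le_rfl
    have h2 := word_inv_word σ hm le_rfl
    have h3 := h (word σ m) (by omega) hle (decide_eq_false (by omega))
    rw [h2, side, if_neg (fun h => by have := ((mem_Ep σ).1 h).2; omega), Nat.succ_le_iff,
      card_pos] at h3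
    obtain ⟨j, hj⟩ := h3
    rw [mem_filter, mem_Nep, mem_Icc] at hj
    omega
  · intro h v hv hvm ht
    have ht : ¬ word σ⁻¹ v < v := of_decide_eq_false ht
    have hp := word_mem σ⁻¹ (i := v) (by rw [mem_Icc]; omega)
    have hw := word_word_inv σ (i := v) (by omega) hvm
    rw [mem_Icc] at hp
    have hpm : word σ⁻¹ v ≠ m := fun he => by rw [he] at hw; omega
    rw [side, if_neg (fun h => by have := ((mem_Ep σ).1 h).2; omega), Nat.succ_le_iff, card_pos]
    refine ⟨m, ?_⟩
    rw [mem_filter, mem_Nep, mem_Icc]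
    omega

end ShiftedHist

/-- Replace each weight by its complement among the weights of a shifted history. -/
def shiftRev : List Step → List Step
  | [] => []
  | (b, t, s) :: l => (b, t, if l = [] then s else lht l + 1 - 2 * t.toNat - s) :: shiftRev l

@[simp] lemma length_shiftRev (l : List Step) : (shiftRev l).length = l.length := by
  induction l with
  | nil => rfl
  | cons x l ih => obtain ⟨b, t, s⟩ := x; simp [shiftRev, ih]

@[simp] lemma shiftRev_eq_nil {l : List Step} : shiftRev l = [] ↔ l = [] := by
  rw [← List.length_eq_zero_iff, length_shiftRev, List.length_eq_zero_iff]

@[simp] lemma lht_shiftRev (l : List Step) : lht (shiftRev l) = lht l := by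
  induction l with
  | nil => rfl
  | cons x l ih => obtain ⟨b, t, s⟩ := x; simp [shiftRev, lht, ih]

@[simp] lemma ldes_shiftRev (l : List Step) : ldes (shiftRev l) = ldes l := by
  induction l with
  | nil => rfl
  | cons x l ih => obtain ⟨b, t, s⟩ := x; simp [shiftRev, ldes, ih]

@[simp] lemma lbot_shiftRev (l : List Step) : lbot (shiftRev l) = lbot l := by
  induction l with
  | nil => rfl
  | cons x l ih => obtain ⟨b, t, s⟩ := x; simp [shiftRev, lbot, ih]

@[simp] lemma ldif_shiftRev (l : List Step) : ldif (shiftRev l) = ldif l := by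
  induction l with
  | nil => rfl
  | cons x l ih => obtain ⟨b, t, s⟩ := x; simp [shiftRev, ldif, lht, ih]

/-- The weights range over `1, …, h` without a top and over `0, …, h - 1` with one; `s ↦ h + 1 - 2 *
t.toNat - s` reverses both ranges. -/
lemma shiftRev_step {t : Bool} {s h : ℕ} (h1 : s + t.toNat ≤ h) (h2 : t = false → 1 ≤ s) :
    s ≤ h + 1 - 2 * t.toNat ∧ h + 1 - 2 * t.toNat - s + t.toNat ≤ h ∧ 2 * t.toNat ≤ h + 1 ∧
      (t = false → 1 ≤ h + 1 - 2 * t.toNat - s) := by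
  cases t <;> simp at * <;> omega

lemma valid_shiftRev {l : List Step} (hl : Valid l) (hs : Shifted l) : Valid (shiftRev l) := by
  induction l with
  | nil => trivial
  | cons x l ih =>
    obtain ⟨b, t, s⟩ := x
    obtain ⟨h1, h2⟩ := hl
    obtain ⟨h3, h4⟩ := hs
    refine ⟨ih h1 h3, ?_⟩
    rw [lht_shiftRev]
    by_cases hnil : l = []
    · rwa [if_pos hnil]
    · rw [if_neg hnil]
      exact (shiftRev_step h2 fun ht => h4 ht hnil).2.1

lemma shifted_shiftRev {l : List Step} (hl : Valid l) (hs : Shifted l) : Shifted (shiftRev l) := by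
  induction l with
  | nil => trivial
  | cons x l ih =>
    obtain ⟨b, t, s⟩ := x
    obtain ⟨h1, h2⟩ := hl
    obtain ⟨h3, h4⟩ := hs
    refine ⟨ih h1 h3, fun ht hnil => ?_⟩
    rw [Ne, shiftRev_eq_nil] at hnil
    rw [if_neg hnil]
    exact (shiftRev_step h2 fun ht => h4 ht hnil).2.2.2 ht

lemma shiftRev_shiftRev {l : List Step} (hl : Valid l) (hs : Shifted l) :
    shiftRev (shiftRev l) = l := by
  induction l with
  | nil => rfl
  | cons x l ih =>
    obtain ⟨b, t, s⟩ := x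
    obtain ⟨h1, h2⟩ := hl
    obtain ⟨h3, h4⟩ := hs
    simp only [shiftRev, shiftRev_eq_nil, lht_shiftRev, ih h1 h3]
    by_cases hnil : l = []
    · simp only [if_pos hnil]
    · have := (shiftRev_step h2 fun ht => h4 ht hnil).1
      simp only [if_neg hnil]
      rw [Nat.sub_sub_self this]

/-- Each step but the first contributes `h + 1 - 2 * t.toNat` with `h` the height before it. The
first step has weight 0 and stays fixed, which accounts for the extra 1. -/
lemma lsum_shiftRev {l : List Step} (hl : Valid l) (hs : Shifted l) (hne : l ≠ []) :
    lsum (shiftRev l) + lsum l + 2 * ldes l + 1 = ldif l + lht l + l.length := by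
  induction l with
  | nil => exact absurd rfl hne
  | cons x l ih =>
    obtain ⟨b, t, s⟩ := x
    obtain ⟨h1, h2⟩ := hl
    obtain ⟨h3, h4⟩ := hs
    by_cases hnil : l = []
    · subst hnil
      simp only [lht] at h2
      simp only [shiftRev, lsum, ldes, ldif, lht, if_true, List.length_cons, List.length_nil]
      omega
    · have h5 := ih h1 h3 hnil
      have h6 := shiftRev_step h2 fun ht => h4 ht hnil
      simp only [shiftRev, if_neg hnil, lsum, ldes, ldif, lht, List.length_cons]
      omega

section EquidistShift

variable {n : ℕ} {f g : Equiv.Perm (Fin n) → ℤ}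

/-- Matches permutations of size `n` whose shifts have the same history; the shift is what brings
the last letters into the comparison. -/
lemma cyc_equidist_lin_of_shift (hn : 1 ≤ n)
    (h : ∀ π σ : Equiv.Perm (Fin n), ebot σ = dbot π → exc σ = des π →
      edif σ + last σ = ddif π + last π → ine σ + last σ = pat2_31 π + last π → f σ = g π) :
    Equidist f g := by
  refine equidist_of_related (D := fun π => linHist (linShift π))
    (D' := fun π => cycHist (cycShift π)) (ι := id)
    (fun π σ he => linShift_injective (linHist_injective he)) (fun π => ?_) fun π σ he => ?_
  · obtain ⟨τ, hτ⟩ := exists_cycHist_eq (valid_linHist (linShift π)) (length_linHist _)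
      (lht_linHist _)
    have hs : word τ (n + 1) = 1 := by
      rw [← shifted_cycHist_iff (by omega), hτ, shifted_linHist_iff (by omega), word_linShift_last]
    obtain ⟨ρ, rfl⟩ := exists_cycShift_eq hs
    exact ⟨ρ, hτ⟩
  · have h1 := congrArg lbot he
    have h2 := congrArg ldif he
    have h3 := congrArg ldes he
    have h4 := congrArg lsum he
    simp only [id, lbot_linHist, ldif_linHist, ldes_linHist, lsum_linHist, lbot_cycHist,
      ldif_cycHist, ldes_cycHist, lsum_cycHist, dbot_linShift π hn, ddif_linShift π hn,
      des_linShift π hn, ebot_cycShift σ hn, edif_cycShift σ hn, exc_cycShift σ hn] at h1 h2 h3 h4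
    have h5 := pat2_31_linShift π hn
    have h6 := ine_cycShift σ hn
    exact h π σ (by omega) (by omega) (by omega) (by omega)

/-- `shiftRev` keeps bottoms and tops, and its effect on the weight sum, pulled back along
`linShift`, exchanges 2-31 with 31-2 up to `des`, `last` and `n`. -/
lemma equidist_shiftRev (hn : 1 ≤ n)
    (h : ∀ π σ : Equiv.Perm (Fin n), dbot σ = dbot π → des σ = des π →
      ddif σ + last σ = ddif π + last π →
      pat2_31 σ + last σ + des π + 1 = pat31_2 π + n + 1 → f σ = g π) : Equidist f g := by
  have hs : ∀ π : Equiv.Perm (Fin n), Shifted (linHist (linShift π)) := fun π => by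
    rw [shifted_linHist_iff (by omega), word_linShift_last]
  refine equidist_of_related (D := fun π => linHist (linShift π))
    (D' := fun π => linHist (linShift π)) (ι := shiftRev)
    (fun π σ he => ?_) (fun π => ?_) fun π σ he => ?_
  · have := congrArg shiftRev he
    rw [shiftRev_shiftRev (valid_linHist _) (hs π), shiftRev_shiftRev (valid_linHist _) (hs σ)]
      at this
    exact linShift_injective (linHist_injective this)
  · have h1 := valid_linHist (linShift π)
    obtain ⟨τ, hτ⟩ := exists_linHist_eq (valid_shiftRev h1 (hs π))
      (by rw [length_shiftRev, length_linHist]) (by rw [lht_shiftRev, lht_linHist])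
    have hs : word τ (n + 1) = 1 := by
      rw [← shifted_linHist_iff (by omega), hτ]
      exact shifted_shiftRev h1 (hs π)
    obtain ⟨ρ, rfl⟩ := exists_linShift_eq hs
    exact ⟨ρ, hτ⟩
  · have h1 := congrArg lbot he
    have h2 := congrArg ldif he
    have h3 := congrArg ldes he
    have h4 := congrArg lsum he
    have h5 := lsum_shiftRev (valid_linHist _) (hs π) fun h0 => by
      have := congrArg List.length h0
      rw [length_linHist] at this
      simp at this
    simp only [lbot_linHist, ldif_linHist, ldes_linHist, lsum_linHist, lbot_shiftRev,
      ldif_shiftRev, ldes_shiftRev, dbot_linShift _ hn, ddif_linShift _ hn, lht_linHist,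
      length_linHist, des_linShift _ hn] at h1 h2 h3 h4 h5
    have h6 := pat2_31_linShift π hn
    have h7 := pat2_31_linShift σ hn
    have h8 := pat2_31_add_pat31_2_add_des π
    exact h π σ (by omega) (by omega) (by omega) (by omega)

end EquidistShift

/-! ### Complementation -/

section Compl

variable {n : ℕ} (π : Equiv.Perm (Fin n))

lemma word_compl_add {i : ℕ} (h1 : 1 ≤ i) (h2 : i ≤ n) : word (compl π) i + word π i = n + 1 := by
  rw [word_eq _ h1 h2, word_eq _ h1 h2, compl, Equiv.trans_apply, Fin.revPerm_apply, Fin.val_rev]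
  omega

lemma compl_injective : Function.Injective (compl (n := n)) := by
  intro π σ h
  refine word_ext fun i hi => ?_
  rw [mem_Icc] at hi
  have h1 := word_compl_add π hi.1 hi.2
  have h2 := word_compl_add σ hi.1 hi.2
  rw [h] at h1
  omega

lemma pat13_2_compl : pat13_2 (compl π) = pat31_2 π := by
  rw [pat13_2, pat31_2]
  refine congrArg card (filter_congr fun p hp => ?_)
  rw [mem_product, mem_Ico, mem_Icc] at hp
  have h1 := word_compl_add π (i := p.1) (by omega) (by omega)
  have h2 := word_compl_add π (i := p.1 + 1) (by omega) (by omega)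
  have h3 := word_compl_add π (i := p.2) (by omega) (by omega)
  omega

lemma pat31_2_compl : pat31_2 (compl π) = pat13_2 π := by
  rw [pat13_2, pat31_2]
  refine congrArg card (filter_congr fun p hp => ?_)
  rw [mem_product, mem_Ico, mem_Icc] at hp
  have h1 := word_compl_add π (i := p.1) (by omega) (by omega)
  have h2 := word_compl_add π (i := p.1 + 1) (by omega) (by omega)
  have h3 := word_compl_add π (i := p.2) (by omega) (by omega)
  omega

lemma sum_Icc_eq_sum_Ico_add (hn : 1 ≤ n) (f : ℕ → ℤ) :
    ∑ i ∈ Icc 1 n, f i = ∑ i ∈ Ico 1 n, f i + f n := by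
  rw [← sum_Ico_succ_top hn]
  refine sum_congr ?_ fun _ _ => rfl
  ext i
  simp only [mem_Icc, mem_Ico]
  omega

lemma sum_Icc_eq_add_sum_Ico (hn : 1 ≤ n) (f : ℕ → ℤ) :
    ∑ i ∈ Icc 1 n, f i = f 1 + ∑ i ∈ Ico 1 n, f (i + 1) := by
  rw [sum_Ico_add' f 1 n 1, ← sum_eq_sum_Ico_succ_bot (by omega)]
  refine sum_congr ?_ fun _ _ => rfl
  ext i
  simp only [mem_Icc, mem_Ico]
  omega

lemma sum_Ico_sub_succ (hn : 1 ≤ n) (g : ℕ → ℤ) :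
    ∑ j ∈ Ico 1 n, (g j - g (j + 1)) = g 1 - g n := by
  induction n, hn using Nat.le_induction with
  | base => simp
  | succ m hm ih => rw [sum_Ico_succ_top hm, ih]; ring

lemma sum_asc_eq : (∑ j ∈ Ico 1 n, if word π j < word π (j + 1) then (1 : ℤ) else 0)
    = (n - 1 : ℕ) - des π := by
  have h : (∑ j ∈ Ico 1 n, if word π j < word π (j + 1) then (1 : ℤ) else 0) + des π
      = ∑ j ∈ Ico 1 n, 1 := by
    rw [des, Des, card_filter]
    push_cast
    rw [← sum_add_distrib]
    refine sum_congr rfl fun j hj => ?_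
    rw [mem_Ico] at hj
    have h1 : word π j ≠ word π (j + 1) := fun h => by
      have := word_inj π (i := j) (j := j + 1) (by rw [mem_Icc]; omega) (by rw [mem_Icc]; omega) h
      omega
    split_ifs <;> omega
  simp only [sum_const, Nat.card_Ico, nsmul_eq_mul, mul_one] at h
  omega

lemma des_compl (hn : 1 ≤ n) : des (compl π) + des π + 1 = n := by
  have h := sum_asc_eq π
  have h2 : (des (compl π) : ℤ)
      = ∑ j ∈ Ico 1 n, if word π j < word π (j + 1) then (1 : ℤ) else 0 := by
    rw [des, Des, card_filter]
    push_cast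
    refine sum_congr rfl fun j hj => ?_
    rw [mem_Ico] at hj
    have h1 := word_compl_add π (i := j) (by omega) (by omega)
    have h2 := word_compl_add π (i := j + 1) (by omega) (by omega)
    split_ifs <;> omega
  omega

/-- Each letter `π(i)` is crossed by descents and ascents to its right alternately. -/
lemma pat2_31_add_des_add_last (hn : 1 ≤ n) :
    pat2_31 π + des π + last π = pat2_31 (compl π) + n := by
  have h1 : (pat2_31 π : ℤ) - pat2_31 (compl π) = ∑ i ∈ Icc 1 n,
      ((if word π i < word π (max 1 (i + 1)) then (1 : ℤ) else 0)
        - if word π i < word π (max n (i + 1)) then 1 else 0) := by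
    rw [pat2_31, pat2_31, card_filter, card_filter, sum_product, sum_product]
    push_cast
    rw [← sum_sub_distrib]
    refine sum_congr rfl fun i hi => ?_
    -- Descents minus ascents across `π(i)` telescope. The maximum freezes the sequence up to
    -- position `i + 1`, so that only steps to the right of `i` contribute.
    rw [← sum_Ico_sub_succ hn fun j => if word π i < word π (max j (i + 1)) then (1 : ℤ) else 0,
      ← sum_sub_distrib]
    refine sum_congr rfl fun j hj => ?_
    rw [mem_Icc] at hi
    rw [mem_Ico] at hj
    rcases Nat.lt_or_ge i j with hij | hij
    · rw [max_eq_left (by omega : i + 1 ≤ j), max_eq_left (by omega : i + 1 ≤ j + 1)]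
      have h1 := word_compl_add π (i := j) (by omega) (by omega)
      have h2 := word_compl_add π (i := j + 1) (by omega) (by omega)
      have h3 := word_compl_add π (i := i) (by omega) (by omega)
      have h4 : word π i ≠ word π j := fun h => by
        have := word_inj π (i := i) (j := j) (by rw [mem_Icc]; omega) (by rw [mem_Icc]; omega) h
        omega
      have h5 : word π i ≠ word π (j + 1) := fun h => by
        have := word_inj π (i := i) (j := j + 1) (by rw [mem_Icc]; omega)
          (by rw [mem_Icc]; omega) h
        omega
      split_ifs <;> omega
    · rw [max_eq_right (by omega : j ≤ i + 1), max_eq_right (by omega : j + 1 ≤ i + 1),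
        if_neg (by omega), if_neg (by omega)]
      ring
  have h2 := card_letters_lt π (v := last π) (word_mem π (by simp [hn]))
  have h3 := sum_asc_eq π
  have h4 : (∑ i ∈ Icc 1 n, ((if word π i < word π (max 1 (i + 1)) then (1 : ℤ) else 0)
        - if word π i < word π (max n (i + 1)) then 1 else 0))
      = (∑ i ∈ Ico 1 n, if word π i < word π (i + 1) then (1 : ℤ) else 0)
        - ∑ i ∈ Icc 1 n, if word π i < last π then 1 else 0 := by
    rw [sum_Icc_eq_sum_Ico_add hn, sum_Icc_eq_sum_Ico_add hn fun i =>
      if word π i < last π then 1 else 0, last, if_neg (lt_irrefl _), max_eq_right (by omega : 1 ≤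
          n + 1),
      max_eq_right (by omega : n ≤ n + 1), sub_self, add_zero, add_zero, ← sum_sub_distrib]
    refine sum_congr rfl fun i hi => ?_
    rw [mem_Ico] at hi
    rw [max_eq_right (by omega : 1 ≤ i + 1), max_eq_left (by omega : i + 1 ≤ n)]
  have h5 := one_le_last π hn
  replace h2 := congrArg (Nat.cast : ℕ → ℤ) h2
  push_cast at h2
  rw [h4, h3, h2] at h1
  omega

lemma sum_word_succ_lt : (∑ j ∈ Ico 1 n, if word π (j + 1) < word π j then (1 : ℤ) else 0)
    = des π := by
  rw [des, Des, card_filter]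
  push_cast
  rfl

/-- Each letter `π(i)` is crossed by descents and ascents to its left alternately. -/
lemma pat31_2_add_des (hn : 1 ≤ n) : pat31_2 π + des π + 1 = pat13_2 π + word π 1 := by
  have h1 : (pat31_2 π : ℤ) - pat13_2 π = ∑ i ∈ Icc 1 n,
      ((if word π i < word π (min 1 (i - 1)) then (1 : ℤ) else 0)
        - if word π i < word π (min n (i - 1)) then 1 else 0) := by
    rw [pat31_2, pat13_2, card_filter, card_filter, sum_product, sum_product, sum_comm,
      sum_comm (s := Ico 1 n) (t := Icc 1 n)]
    push_cast
    rw [← sum_sub_distrib]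
    refine sum_congr rfl fun i hi => ?_
    -- Likewise the minimum freezes the sequence from position `i - 1` on. For `i = 1` both ends are
    -- position 0 and cancel.
    rw [← sum_Ico_sub_succ hn fun j => if word π i < word π (min j (i - 1)) then (1 : ℤ) else 0,
      ← sum_sub_distrib]
    refine sum_congr rfl fun j hj => ?_
    rw [mem_Icc] at hi
    rw [mem_Ico] at hj
    rcases Nat.lt_or_ge (j + 1) i with hij | hij
    · rw [min_eq_left (by omega : j ≤ i - 1), min_eq_left (by omega : j + 1 ≤ i - 1)]
      have h4 : word π i ≠ word π j := fun h => by
        have := word_inj π (i := i) (j := j) (by rw [mem_Icc]; omega) (by rw [mem_Icc]; omega) h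
        omega
      have h5 : word π i ≠ word π (j + 1) := fun h => by
        have := word_inj π (i := i) (j := j + 1) (by rw [mem_Icc]; omega)
          (by rw [mem_Icc]; omega) h
        omega
      split_ifs <;> omega
    · rw [min_eq_right (by omega : i - 1 ≤ j), min_eq_right (by omega : i - 1 ≤ j + 1),
        if_neg (by omega), if_neg (by omega)]
      ring
  have h2 := card_letters_lt π (v := word π 1) (word_mem π (by simp [hn]))
  have h3 := sum_word_succ_lt π
  have h4 : (∑ i ∈ Icc 1 n, ((if word π i < word π (min 1 (i - 1)) then (1 : ℤ) else 0)
        - if word π i < word π (min n (i - 1)) then 1 else 0))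
      = (∑ i ∈ Icc 1 n, if word π i < word π 1 then (1 : ℤ) else 0)
        - ∑ i ∈ Ico 1 n, if word π (i + 1) < word π i then 1 else 0 := by
    rw [sum_Icc_eq_add_sum_Ico hn, sum_Icc_eq_add_sum_Ico hn fun i =>
      if word π i < word π 1 then 1 else 0, if_neg (lt_irrefl (word π 1)), Nat.sub_self,
          min_eq_right (by omega : 0 ≤ 1),
      min_eq_right (by omega : 0 ≤ n), sub_self, zero_add, zero_add, ← sum_sub_distrib]
    refine sum_congr rfl fun i hi => ?_
    rw [mem_Ico] at hi
    rw [Nat.add_sub_cancel, min_eq_left (by omega : 1 ≤ i), min_eq_right (by omega : i ≤ n)]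
  have h5 := one_le_word π (i := 1) le_rfl hn
  replace h2 := congrArg (Nat.cast : ℕ → ℤ) h2
  push_cast at h2
  rw [h4, h3, h2] at h1
  omega

lemma two_mul_sum_Icc (n : ℕ) : 2 * ∑ i ∈ Icc 1 n, (i : ℤ) = n * (n + 1) := by
  induction n with
  | zero => simp
  | succ n ih =>
    rw [sum_Icc_succ_top (by omega), mul_add, ih]
    push_cast
    ring

/-- Descent bottoms of the complement are complements of ascent tops, and every letter except the
first is either a descent bottom or an ascent top. -/
lemma dbot_compl (hn : 1 ≤ n) :
    (dbot (compl π) : ℤ) + ∑ i ∈ Icc 1 n, (i : ℤ)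
        = dbot π + word π 1 + (n + 1) * des (compl π) := by
  have h1 : (dbot (compl π) : ℤ) + ∑ i ∈ Ico 1 n, (word π (i + 1) : ℤ)
      = dbot π + (n + 1) * des (compl π) := by
    rw [dbot_eq_sum, dbot_eq_sum, des, Des, Des, card_filter, sum_filter, sum_filter]
    push_cast
    rw [mul_sum, ← sum_add_distrib, ← sum_add_distrib]
    refine sum_congr rfl fun j hj => ?_
    rw [mem_Ico] at hj
    have h1 := word_compl_add π (i := j) (by omega) (by omega)
    have h2 := word_compl_add π (i := j + 1) (by omega) (by omega)
    have h4 : word π j ≠ word π (j + 1) := fun h => by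
      have := word_inj π (i := j) (j := j + 1) (by rw [mem_Icc]; omega) (by rw [mem_Icc]; omega) h
      omega
    split_ifs <;> omega
  rw [← sum_word π fun i => (i : ℤ), sum_Icc_eq_add_sum_Ico hn]
  linarith

end Compl

/-! ### The statistics with a shift -/

lemma mul_sub_one_div_two (n : ℕ) : (n * (n - 1) : ℤ) / 2 = (∑ i ∈ Icc 1 n, (i : ℤ)) - n := by
  have h := two_mul_sum_Icc n
  have h1 : (n * (n - 1) : ℤ) = n * (n + 1) - 2 * n := by ring
  omega

lemma mul_sub_three_div_two (n : ℕ) :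
    (n * (n - 3) : ℤ) / 2 = (∑ i ∈ Icc 1 n, (i : ℤ)) - 2 * n := by
  have h := two_mul_sum_Icc n
  have h1 : (n * (n - 3) : ℤ) = n * (n + 1) - 4 * n := by ring
  omega

lemma neg_sq_add_sub_div_two (n : ℕ) :
    (-(n : ℤ) ^ 2 + n - 2) / 2 = -(∑ i ∈ Icc 1 n, (i : ℤ)) + n - 1 := by
  have h := two_mul_sum_Icc n
  have h1 : (-(n : ℤ) ^ 2 + n - 2) = -(n * (n + 1)) + 2 * n - 2 := by ring
  omega

section Shifted

variable {n : ℕ}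

lemma mad'_eq_sist'' (hn : 1 ≤ n) (π : Equiv.Perm (Fin n)) : mad' π = (sist'' (compl π) : ℤ) := by
  have h1 := pat2_31_add_des_add_last π hn
  have h2 := pat2_31_add_pat31_2_add_des π
  have h3 := des_compl π hn
  rw [mad', mad, sist'', pat13_2_compl]
  omega

lemma madl'_eq_sist' (hn : 1 ≤ n) (π : Equiv.Perm (Fin n)) : madl' π = (sist' (compl π) : ℤ) := by
  have h1 := pat2_31_add_des_add_last π hn
  have h2 := pat2_31_add_pat31_2_add_des π
  have h3 := des_compl π hn
  rw [madl', madl, sist', pat13_2_compl]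
  omega

lemma makl'_eq_makl_compl (hn : 1 ≤ n) (π : Equiv.Perm (Fin n)) :
    makl' π = (makl (compl π) : ℤ) := by
  have h1 := pat31_2_add_des π hn
  have h2 := dbot_compl π hn
  have h3 := des_compl π hn
  have h4 := two_mul_sum_Icc n
  have h5 : (des (compl π) : ℤ) = n - 1 - des π := by omega
  rw [makl', makl, makl, pat31_2_compl, mul_sub_one_div_two]
  rw [h5] at h2
  zify at h1
  push_cast
  linarith

lemma inv'_equidist_inv (hn : 1 ≤ n) :
    Equidist (fun π : Equiv.Perm (Fin n) => inv' π) fun π => (inv π : ℤ) := by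
  refine .symm (equidist_of_injective rot_injective fun π => ?_)
  have := inv_rot π hn
  rw [inv']
  omega

lemma makl'_equidist_inv (hn : 1 ≤ n) :
    Equidist (fun π : Equiv.Perm (Fin n) => makl' π) fun π => (inv π : ℤ) :=
  .trans (.symm (equidist_of_injective compl_injective fun π => (makl'_eq_makl_compl hn π).symm))
    makl_equidist_inv

/-- `inv'` is the sum of `edif + last` and `ine + last` up to a constant, so its linear counterpart
is `mad'`. -/
lemma mad'_equidist_inv (hn : 1 ≤ n) :
    Equidist (fun π : Equiv.Perm (Fin n) => mad' π) fun π => (inv π : ℤ) := by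
  refine .trans (.symm (cyc_equidist_lin_of_shift hn fun π σ h1 h2 h3 h4 => ?_))
    (inv'_equidist_inv hn)
  have := inv_eq_edif_add_ine σ
  rw [inv', mad', mad]
  omega

lemma madl'_equidist_inv (hn : 1 ≤ n) :
    Equidist (fun π : Equiv.Perm (Fin n) => madl' π) fun π => (inv π : ℤ) := by
  refine .trans (.symm (equidist_shiftRev hn fun π σ h1 h2 h3 h4 => ?_)) (mad'_equidist_inv hn)
  rw [mad', madl', mad, madl]
  omega

/-- `shiftRev` preserves `dbot` and `des`, and turns 2-31 plus `last` into 31-2 minus `des` plus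
`n`; this explains the different multiples of `des` in `mak'` and `makl'`. -/
lemma mak'_equidist_inv (hn : 1 ≤ n) :
    Equidist (fun π : Equiv.Perm (Fin n) => mak' π) fun π => (inv π : ℤ) := by
  refine .trans (equidist_shiftRev hn fun π σ h1 h2 h3 h4 => ?_) (makl'_equidist_inv hn)
  rw [mak', makl', mak, makl, h1, h2, mul_sub_one_div_two, mul_sub_three_div_two]
  zify at h4
  push_cast
  linarith

lemma den'_equidist_inv (hn : 1 ≤ n) :
    Equidist (fun π : Equiv.Perm (Fin n) => den' π) fun π => (inv π : ℤ) := by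
  refine .trans (cyc_equidist_lin_of_shift hn fun π σ h1 h2 h3 h4 => ?_) (mak'_equidist_inv hn)
  rw [den', mak', den, mak, h1, h2]
  zify at h4
  push_cast
  linarith

lemma fz3'_equidist_inv (hn : 1 ≤ n) :
    Equidist (fun π : Equiv.Perm (Fin n) => fz3' π) fun π => (inv π : ℤ) := by
  refine .trans (cyc_equidist_lin_of_shift hn fun π σ h1 h2 h3 h4 => ?_) (makl'_equidist_inv hn)
  have h5 := pat2_31_add_pat31_2_add_des π
  rw [fz3', fz3, makl', makl, h1, h2]
  zify at h3 h4 h5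
  push_cast
  linarith

lemma fz4'_equidist_inv (hn : 1 ≤ n) :
    Equidist (fun π : Equiv.Perm (Fin n) => fz4' π) fun π => (inv π : ℤ) := by
  refine .trans (cyc_equidist_lin_of_shift hn fun π σ h1 h2 h3 h4 => ?_) (madl'_equidist_inv hn)
  have h5 := pat2_31_add_pat31_2_add_des π
  rw [fz4', fz4, madl', madl, h2]
  omega

/-! ### Transport along the rotated inverse -/

lemma equidist_rotInv {f g h : Equiv.Perm (Fin n) → ℤ} (h1 : ∀ π, f (rotInv π) = g π)
    (h2 : Equidist f h) : Equidist g h :=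
  (equidist_of_injective rotInv_injective h1).symm.trans h2

variable (π : Equiv.Perm (Fin n))

lemma den_rotInv (hn : 1 ≤ n) : (den (rotInv π) : ℤ) = yzl1 π := by
  rw [den, ebot_rotInv, ine_rotInv π hn, yzl1, Nat.cast_add]

lemma inv_rotInv (hn : 1 ≤ n) : (inv (rotInv π) : ℤ) = yzl2 π := by
  rw [inv_eq_edif_add_ine, edif_rotInv π hn, ine_rotInv π hn, yzl2, Nat.cast_add]

lemma fz3_rotInv (hn : 1 ≤ n) : fz3 (rotInv π) = yzl3 π := by
  rw [fz3, ebot_rotInv, edif_rotInv π hn, ine_rotInv π hn, exc_rotInv π hn, yzl3]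

lemma fz4_rotInv (hn : 1 ≤ n) : fz4 (rotInv π) = yzl4 π := by
  rw [fz4, edif_rotInv π hn, ine_rotInv π hn, exc_rotInv π hn, yzl4]

lemma den'_rotInv (hn : 1 ≤ n) : den' (rotInv π) = yzl1' π := by
  rw [den', den_rotInv π hn, exc_rotInv π hn, last_rotInv π hn, yzl1', mul_sub_three_div_two,
    neg_sq_add_sub_div_two]
  have := two_mul_sum_Icc n
  linarith

lemma inv'_rotInv (hn : 1 ≤ n) : inv' (rotInv π) = yzl2' π := by
  rw [inv', inv_rotInv π hn, last_rotInv π hn, yzl2']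
  ring

lemma fz3'_rotInv (hn : 1 ≤ n) : fz3' (rotInv π) = yzl3' π := by
  rw [fz3', fz3_rotInv π hn, exc_rotInv π hn, yzl3', mul_sub_one_div_two]
  have := two_mul_sum_Icc n
  linarith

lemma fz4'_rotInv (hn : 1 ≤ n) : fz4' (rotInv π) = yzl4' π := by
  rw [fz4', fz4_rotInv π hn, exc_rotInv π hn, last_rotInv π hn, yzl4']
  ring

end Shifted

end PermStat

theorem theorem4p14 :
    (PermStat.IsMahonian PermStat.mak' ∧
      PermStat.IsMahonian PermStat.mad' ∧
      PermStat.IsMahonian PermStat.makl' ∧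
      PermStat.IsMahonian PermStat.madl' ∧
      PermStat.IsMahonian PermStat.fz3 ∧
      PermStat.IsMahonian PermStat.fz4 ∧
      PermStat.IsMahonian PermStat.inv' ∧
      PermStat.IsMahonian PermStat.den' ∧
      PermStat.IsMahonian PermStat.fz3' ∧
      PermStat.IsMahonian PermStat.fz4' ∧
      PermStat.IsMahonian PermStat.yzl1 ∧
      PermStat.IsMahonian PermStat.yzl2 ∧
      PermStat.IsMahonian PermStat.yzl3 ∧
      PermStat.IsMahonian PermStat.yzl4 ∧
      PermStat.IsMahonian PermStat.yzl1' ∧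
      PermStat.IsMahonian PermStat.yzl2' ∧
      PermStat.IsMahonian PermStat.yzl3' ∧
      PermStat.IsMahonian PermStat.yzl4') ∧
    ∀ (n : ℕ), 1 ≤ n → ∀ π : Equiv.Perm (Fin n),
      PermStat.mad' π = (PermStat.sist'' (PermStat.compl π) : ℤ) ∧
      PermStat.madl' π = (PermStat.sist' (PermStat.compl π) : ℤ) ∧
      PermStat.makl' π = (PermStat.makl (PermStat.compl π) : ℤ) := by
  refine ⟨⟨fun n hn => PermStat.mak'_equidist_inv hn, fun n hn => PermStat.mad'_equidist_inv hn,
    fun n hn => PermStat.makl'_equidist_inv hn, fun n hn => PermStat.madl'_equidist_inv hn,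
    fun n _ => PermStat.fz3_equidist_inv, fun n _ => PermStat.fz4_equidist_inv,
    fun n hn => PermStat.inv'_equidist_inv hn, fun n hn => PermStat.den'_equidist_inv hn,
    fun n hn => PermStat.fz3'_equidist_inv hn, fun n hn => PermStat.fz4'_equidist_inv hn,
    fun n hn => ?_, fun n hn => ?_, fun n hn => ?_, fun n hn => ?_,
    fun n hn => ?_, fun n hn => ?_, fun n hn => ?_, fun n hn => ?_⟩,
    fun n hn π => ⟨PermStat.mad'_eq_sist'' hn π, PermStat.madl'_eq_sist' hn π,
      PermStat.makl'_eq_makl_compl hn π⟩⟩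
  · exact PermStat.equidist_rotInv (PermStat.den_rotInv · hn) PermStat.den_equidist_inv
  · exact PermStat.equidist_rotInv (PermStat.inv_rotInv · hn) fun _ => rfl
  · exact PermStat.equidist_rotInv (PermStat.fz3_rotInv · hn) PermStat.fz3_equidist_inv
  · exact PermStat.equidist_rotInv (PermStat.fz4_rotInv · hn) PermStat.fz4_equidist_inv
  · exact PermStat.equidist_rotInv (PermStat.den'_rotInv · hn) (PermStat.den'_equidist_inv hn)
  · exact PermStat.equidist_rotInv (PermStat.inv'_rotInv · hn) (PermStat.inv'_equidist_inv hn)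
  · exact PermStat.equidist_rotInv (PermStat.fz3'_rotInv · hn) (PermStat.fz3'_equidist_inv hn)
  · exact PermStat.equidist_rotInv (PermStat.fz4'_rotInv · hn) (PermStat.fz4'_equidist_inv hn)
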